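/- Let $D=\{z\in\mathbb{C}: |\operatorname{Re} z-\tfrac12|+|\operatorname{Im} z|<\tfrac12\}$ be the open square with diagonals $(0,1)$ and $(\tfrac12-\tfrac i2,\tfrac12+\tfrac i2)$ (open segments), let $dA$ be planar Lebesgue measure, and let $A^2(D)$ be the space of holomorphic functions $f$ on $D$ with $\int_D|f|^2\,dA<\infty$. For a function $f$ that is $C^\infty$ on each of the two open diagonals put $$S(f)=\sum_{n=0}^{\infty}\frac{2^n}{(2n+1)!}\int_0^{1/2}x^{2n+1}\Big(|f^{(n)}(x)|^2+|f^{(n)}(1-x)|^2+\big|f^{(n)}\big(\tfrac12+i(\tfrac12-x)\big)\big|^2+\big|f^{(n)}\big(\tfrac12+i(x-\tfrac12)\big)\big|^2\Big)\,dx\in[0,\infty],$$ where $f^{(n)}$ is the $n$-th complex derivative if $f$ is holomorphic on $D$, and in general the $n$-th derivative along the diagonal, that is, $f^{(n)}(x)=\frac{d^n}{dx^n}f(x)$ on $(0,1)$ and $f^{(n)}(\tfrac12+it)=(-i)^n\frac{d^n}{dt^n}f(\tfrac12+it)$ on the other diagonal. Theorem. There are absolute constants $c,C>0$ such that the following hold.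 (1) For every $f\in A^2(D)$, $$c\int_D|f|^2\,dA\le S(f)\le C\int_D|f|^2\,dA.$$ (2) Let $f$ be a function on the union of the two open diagonals and a neighborhood of $\tfrac12$ which is $C^\infty$ on each of the two open diagonals and holomorphic in that neighborhood of $\tfrac12$. If $S(f)<\infty$, then there is $F\in A^2(D)$ that coincides with $f$ on both diagonals and near $\tfrac12$, and $$c\int_D|F|^2\,dA\le S(f)\le C\int_D|F|^2\,dA.$$ -/

import Mathlib

open MeasureTheory Set Filter Topology
open scoped ENNReal NNReal ContDiff

/-- The open square with diagonals `(0, 1)` and `(1/2 - i/2, 1/2 + i/2)`. -/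
def square : Set ℂ := {z | |z.re - 1 / 2| + |z.im| < 1 / 2}

/-- The horizontal diagonal, the open segment from `0` to `1`. -/
def horizontalDiagonal : Set ℂ := {z | z.re ∈ Ioo (0 : ℝ) 1 ∧ z.im = 0}

/-- The vertical diagonal, the open segment from `1/2 - i/2` to `1/2 + i/2`. -/
def verticalDiagonal : Set ℂ := {z | z.re = 1 / 2 ∧ z.im ∈ Ioo (-(1 / 2) : ℝ) (1 / 2)}

/-- The squared Bergman norm `∫_D |f|² dA` on the square (possibly infinite). -/
noncomputable def bergmanNormSq (f : ℂ → ℂ) : ℝ≥0∞ :=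
  ∫⁻ z in square, ‖f z‖ₑ ^ 2

/-- `f` belongs to the Bergman space `A²(D)` of the square: it is holomorphic and square
integrable there. -/
def MemBergman (f : ℂ → ℂ) : Prop :=
  DifferentiableOn ℂ f square ∧ bergmanNormSq f < ⊤

/-- The sum over `n` of `2^n / (2n+1)! ∫_0^{1/2} x^(2n+1) (…) dx`, where `d n z` stands for the
`n`-th derivative at the point `z`, and where the bracket adds `|d n z|²` over the four points
`x`, `1 - x`, `1/2 + i (1/2 - x)` and `1/2 + i (x - 1/2)` of the two diagonals. -/
noncomputable def diagonalSum (d : ℕ → ℂ → ℂ) : ℝ≥0∞ :=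
  ∑' n : ℕ, ENNReal.ofReal (2 ^ n / ((2 * n + 1).factorial : ℝ)) *
    ∫⁻ x : ℝ in Ioo (0 : ℝ) (1 / 2),
      ENNReal.ofReal (x ^ (2 * n + 1) *
        (‖d n (x : ℂ)‖ ^ 2 + ‖d n (1 - (x : ℂ))‖ ^ 2
          + ‖d n (1 / 2 + Complex.I * (1 / 2 - (x : ℂ)))‖ ^ 2
          + ‖d n (1 / 2 + Complex.I * ((x : ℂ) - 1 / 2))‖ ^ 2))

/-- The `n`-th derivative at `z` along the diagonals, for a function that need only be smooth on
the two diagonals. On the horizontal diagonal it is the `n`-th derivative of `t ↦ f t`. On the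
vertical one, `z = 1/2 + i t`, so `d/dz = -i d/dt`. -/
noncomputable def derivAlongDiagonals (f : ℂ → ℂ) (n : ℕ) (z : ℂ) : ℂ :=
  if z.im = 0 then iteratedDeriv n (fun t : ℝ => f (t : ℂ)) z.re
  else (-Complex.I) ^ n * iteratedDeriv n (fun t : ℝ => f (1 / 2 + Complex.I * (t : ℂ))) z.im

/-- `f` is of class `C^∞` on each of the two open diagonals (as a function of a real parameter). -/
def SmoothOnDiagonals (f : ℂ → ℂ) : Prop :=
  ContDiffOn ℝ ∞ (fun t : ℝ => f (t : ℂ)) (Ioo (0 : ℝ) 1) ∧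
  ContDiffOn ℝ ∞ (fun t : ℝ => f (1 / 2 + Complex.I * (t : ℂ))) (Ioo (-(1 / 2) : ℝ) (1 / 2))

/-!
Integrate the squared norm of `f = ∑ aₙ (z - x)ⁿ` over the disc about `x` that touches the two sides
of the square at the vertex `0`, against the radial kernel `1 / (π √(x² - 2|z - x|²))`. The powers
are orthogonal, the moments of the kernel are Wallis integrals, and the outcome is exactly the
`n`-sum at `x` in `S(f)`. Integrating in `x` over the half diagonal from `0` to `1/2` and exchanging
the integrals, the contribution of that half diagonal becomes `∫ |f|² w`, where the weight `w z` is
the integral of the kernel in `x`. For fixed `z` the kernel is an arcsine density in `x`, so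
`w ≤ 1`; if `z` lies in the quarter of the square adjacent to `0`, at least a quarter of that
distribution lies below `1/2`, so `1/4 ≤ w z`. Rotating the square and summing over its four
vertices gives the estimates of `S(f)` with the constants `1/4` and `4`.

For the extension, a smooth function of finite sum on a half diagonal satisfies
`|f⁽ⁿ⁾(x)| ρⁿ ≤ C n!` for every `ρ < x/√2`, locally uniformly in `x`: a one-dimensional Sobolev
inequality turns the integrals of `|f⁽ⁿ⁾|²` and `|f⁽ⁿ⁺¹⁾|²` into pointwise bounds. Hence `f` is the
sum of its Taylor series on the discs above, and these sums agree on overlaps. The four extensions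
share their germ at `1/2`, and any two of their domains meet only inside the inscribed disc of the
square, so they glue.
-/

section SineSubstitution

open Real

variable {s α β : ℝ}

lemma image_add_mul_sin_Ioo (m : ℝ) (hs : 0 < s) (hα : -(π / 2) ≤ α) (hβ : β ≤ π / 2)
    (hαβ : α ≤ β) :
    (fun φ ↦ m + s * sin φ) '' Ioo α β = Ioo (m + s * sin α) (m + s * sin β) := by
  apply Subset.antisymm
  · rintro _ ⟨φ, hφ, rfl⟩
    have hαφ := sin_lt_sin_of_lt_of_le_pi_div_two hα (hφ.2.le.trans hβ) hφ.1
    have hφβ := sin_lt_sin_of_lt_of_le_pi_div_two (hα.trans hφ.1.le) hβ hφ.2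
    constructor <;> simp only <;> gcongr
  · exact intermediate_value_Ioo (f := fun φ ↦ m + s * sin φ) hαβ (by fun_prop)

lemma setLIntegral_eq_setLIntegral_cos_mul_comp_sin (m : ℝ) (hs : 0 < s) (hα : -(π / 2) ≤ α)
    (hβ : β ≤ π / 2) (hαβ : α ≤ β) (g : ℝ → ℝ≥0∞) :
    ∫⁻ t in Ioo (m + s * sin α) (m + s * sin β), g t =
      ∫⁻ φ in Ioo α β, ENNReal.ofReal (s * cos φ) * g (m + s * sin φ) := by
  have hsub : Ioo α β ⊆ Icc (-(π / 2)) (π / 2) :=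
    fun φ hφ ↦ ⟨hα.trans hφ.1.le, hφ.2.le.trans hβ⟩
  have hinj : InjOn (fun φ ↦ m + s * sin φ) (Ioo α β) := fun φ hφ ψ hψ h ↦
    injOn_sin (hsub hφ) (hsub hψ) (mul_left_cancel₀ hs.ne' (add_left_cancel h))
  rw [← image_add_mul_sin_Ioo m hs hα hβ hαβ,
    lintegral_image_eq_lintegral_abs_deriv_mul measurableSet_Ioo
      (fun φ _ ↦ (((hasDerivAt_sin φ).const_mul s).const_add m).hasDerivWithinAt) hinj]
  refine setLIntegral_congr_fun measurableSet_Ioo fun φ hφ ↦ ?_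
  simp only [abs_of_nonneg (mul_nonneg hs.le (cos_nonneg_of_mem_Icc (hsub hφ)))]

lemma mul_cos_mul_inv_sqrt_sq_sub {φ : ℝ} (hs : 0 < s) (hφ : 0 < cos φ) :
    s * cos φ * (√(s ^ 2 - (s * sin φ) ^ 2))⁻¹ = 1 := by
  have hsq : s ^ 2 - (s * sin φ) ^ 2 = (s * cos φ) ^ 2 := by
    linear_combination (-s ^ 2) * sin_sq_add_cos_sq φ
  rw [hsq, sqrt_sq (by positivity), mul_inv_cancel₀ (by positivity)]

lemma setLIntegral_arcsine (m : ℝ) (hs : 0 < s) (hα : -(π / 2) ≤ α) (hβ : β ≤ π / 2)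
    (hαβ : α ≤ β) :
    ∫⁻ t in Ioo (m + s * sin α) (m + s * sin β),
      ENNReal.ofReal ((π * √(s ^ 2 - (t - m) ^ 2))⁻¹) = ENNReal.ofReal ((β - α) / π) := by
  have hconst : EqOn (fun φ ↦ ENNReal.ofReal (s * cos φ) *
      ENNReal.ofReal ((π * √(s ^ 2 - (m + s * sin φ - m) ^ 2))⁻¹))
      (fun _ ↦ ENNReal.ofReal π⁻¹) (Ioo α β) := by
    intro φ hφ
    have hcos : 0 < cos φ := cos_pos_of_mem_Ioo ⟨by linarith [hφ.1], by linarith [hφ.2]⟩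
    simp only [add_sub_cancel_left, mul_inv]
    rw [← ENNReal.ofReal_mul (by positivity)]
    congr 1
    linear_combination π⁻¹ * mul_cos_mul_inv_sqrt_sq_sub hs hcos
  rw [setLIntegral_eq_setLIntegral_cos_mul_comp_sin m hs hα hβ hαβ,
    setLIntegral_congr_fun measurableSet_Ioo hconst, setLIntegral_const, volume_Ioo,
    ← ENNReal.ofReal_mul (by positivity), inv_mul_eq_div]

lemma lintegral_arcsine_le_one (m q : ℝ) :
    ∫⁻ t, ENNReal.ofReal ((π * √(q - (t - m) ^ 2))⁻¹) ≤ 1 := by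
  rcases le_or_gt q 0 with hq | hq
  · have hzero : ∀ t : ℝ, √(q - (t - m) ^ 2) = 0 := fun t ↦
      sqrt_eq_zero_of_nonpos (by nlinarith [sq_nonneg (t - m)])
    simp [hzero]
  obtain ⟨s, hs, rfl⟩ : ∃ s : ℝ, 0 < s ∧ q = s ^ 2 := ⟨√q, sqrt_pos.2 hq, (sq_sqrt hq.le).symm⟩
  have hsupport : ∀ t ∉ Ioo (m - s) (m + s),
      ENNReal.ofReal ((π * √(s ^ 2 - (t - m) ^ 2))⁻¹) = 0 := by
    intro t ht
    rw [mem_Ioo, not_and_or, not_lt, not_lt] at ht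
    rw [sqrt_eq_zero_of_nonpos (by rcases ht with ht | ht <;> nlinarith)]
    simp
  have htotal := setLIntegral_arcsine m hs le_rfl le_rfl (neg_le_self pi_div_two_pos.le)
  simp only [sin_neg, sin_pi_div_two, mul_neg, mul_one, ← sub_eq_add_neg, sub_neg_eq_add,
    add_halves, div_self pi_ne_zero, ENNReal.ofReal_one] at htotal
  rw [← htotal, setLIntegral_eq_of_support_subset]
  exact fun t ht ↦ by_contra fun h ↦ ht (hsupport t h)

lemma prod_two_mul_add_two_div_two_mul_add_three (n : ℕ) :
    ∏ i ∈ Finset.range n, (2 * (i : ℝ) + 2) / (2 * i + 3) =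
      4 ^ n * (n.factorial : ℝ) ^ 2 / (2 * n + 1).factorial := by
  induction n with
  | zero => simp
  | succ n ih =>
    rw [Finset.prod_range_succ, ih, show 2 * (n + 1) + 1 = (2 * n + 1) + 1 + 1 by ring,
      Nat.factorial_succ (2 * n + 1 + 1), Nat.factorial_succ (2 * n + 1), Nat.factorial_succ n]
    push_cast
    field_simp
    ring

lemma integral_sin_pow_odd_zero_pi_div_two (n : ℕ) :
    ∫ φ in (0 : ℝ)..π / 2, sin φ ^ (2 * n + 1) =
      4 ^ n * (n.factorial : ℝ) ^ 2 / (2 * n + 1).factorial := by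
  have hreflect := intervalIntegral.integral_comp_sub_left (a := 0) (b := π / 2)
    (fun φ ↦ sin φ ^ (2 * n + 1)) (π / 2)
  simp only [sin_pi_div_two_sub, sub_self, sub_zero] at hreflect
  rw [← hreflect, EulerSine.integral_cos_pow_eq, integral_sin_pow_odd,
    prod_two_mul_add_two_div_two_mul_add_three]
  ring

lemma lintegral_pow_mul_inv_sqrt_sq_sub_sq (hs : 0 < s) (n : ℕ) :
    ∫⁻ r in Ioo 0 s, ENNReal.ofReal (r ^ (2 * n + 1) * (√(s ^ 2 - r ^ 2))⁻¹) =
      ENNReal.ofReal (s ^ (2 * n + 1) *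
        (4 ^ n * (n.factorial : ℝ) ^ 2 / (2 * n + 1).factorial)) := by
  have hsubst := setLIntegral_eq_setLIntegral_cos_mul_comp_sin 0 hs
    (neg_nonpos.2 pi_div_two_pos.le) le_rfl pi_div_two_pos.le
    (fun r ↦ ENNReal.ofReal (r ^ (2 * n + 1) * (√(s ^ 2 - r ^ 2))⁻¹))
  simp only [sin_zero, sin_pi_div_two, mul_zero, mul_one, zero_add] at hsubst
  have hintegrand : EqOn (fun φ ↦ ENNReal.ofReal (s * cos φ) *
      ENNReal.ofReal ((s * sin φ) ^ (2 * n + 1) * (√(s ^ 2 - (s * sin φ) ^ 2))⁻¹))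
      (fun φ ↦ ENNReal.ofReal (s ^ (2 * n + 1) * sin φ ^ (2 * n + 1))) (Ioo 0 (π / 2)) := by
    intro φ hφ
    have hcos : 0 < cos φ := cos_pos_of_mem_Ioo ⟨by linarith [hφ.1, pi_pos], hφ.2⟩
    simp only
    rw [← ENNReal.ofReal_mul (by positivity)]
    congr 1
    linear_combination (s * sin φ) ^ (2 * n + 1) * mul_cos_mul_inv_sqrt_sq_sub hs hcos
  rw [hsubst, setLIntegral_congr_fun measurableSet_Ioo hintegrand,
    ← ofReal_integral_eq_lintegral_ofReal, integral_const_mul, ← integral_Ioc_eq_integral_Ioo,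
    ← intervalIntegral.integral_of_le pi_div_two_pos.le, integral_sin_pow_odd_zero_pi_div_two]
  · exact (Continuous.integrableOn_Icc (by fun_prop)).mono_set Ioo_subset_Icc_self
  · filter_upwards [self_mem_ae_restrict measurableSet_Ioo] with φ hφ
    have hsin : 0 < sin φ := sin_pos_of_pos_of_lt_pi hφ.1 (by linarith [hφ.2, pi_pos])
    simp only [Pi.zero_apply]
    positivity

end SineSubstitution

section Gutzmer

open Real

variable {f : ℂ → ℂ} {c : ℂ} {R r : ℝ}

lemma fourierCoeffOn_comp_circleMap (hr : r ≠ 0) (n : ℤ) :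
    fourierCoeffOn two_pi_pos (fun θ ↦ f (circleMap c r θ)) n =
      r ^ n * ((2 * π * Complex.I)⁻¹ * ∮ z in C(c, r), (z - c) ^ (-(n + 1)) • f z) := by
  rw [fourierCoeffOn_eq_integral, circleIntegral, ← intervalIntegral.integral_const_mul,
    ← intervalIntegral.integral_const_mul, ← intervalIntegral.integral_smul]
  refine intervalIntegral.integral_congr fun θ _ ↦ ?_
  have hr' : (r : ℂ) ≠ 0 := mod_cast hr
  have hexp : Complex.exp (θ * Complex.I) ≠ 0 := Complex.exp_ne_zero _
  have hfourier : (fourier (-n) (θ : AddCircle (2 * π - 0)) : ℂ) =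
      Complex.exp (θ * Complex.I) ^ (-n) := by
    rw [fourier_coe_apply, ← Complex.exp_int_mul]
    congr 1
    push_cast
    field_simp
    ring
  simp only [hfourier, deriv_circleMap, circleMap, smul_eq_mul, add_sub_cancel_left, zero_add,
    sub_zero, Complex.real_smul, Complex.ofReal_div, Complex.ofReal_mul, Complex.ofReal_one,
    Complex.ofReal_ofNat]
  rw [mul_zpow, neg_add, zpow_add₀ hr', zpow_add₀ hexp, zpow_neg_one, zpow_neg_one]
  field_simp
  rw [mul_assoc, ← zpow_add₀ hr', add_neg_cancel, zpow_zero, mul_one]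

lemma fourierCoeffOn_comp_circleMap_natCast (hf : DifferentiableOn ℂ f (Metric.ball c R))
    (hr : 0 < r) (hrR : r < R) (n : ℕ) :
    fourierCoeffOn two_pi_pos (fun θ ↦ f (circleMap c r θ)) n =
      r ^ n * ((n.factorial : ℂ)⁻¹ * iteratedDeriv n f c) := by
  have hcauchy := (hf.diffContOnCl_ball
    (Metric.closedBall_subset_ball hrR)).circleIntegral_one_div_sub_center_pow_smul hr n
  have hpow : ∀ z, (z - c) ^ (-((n : ℤ) + 1)) = 1 / (z - c) ^ (n + 1) := fun z ↦ by
    rw [one_div, zpow_neg]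
    norm_cast
  simp only [fourierCoeffOn_comp_circleMap hr.ne', hpow, zpow_natCast]
  rw [hcauchy, smul_eq_mul]
  field_simp

lemma fourierCoeffOn_comp_circleMap_of_neg (hf : DifferentiableOn ℂ f (Metric.ball c R))
    (hr : 0 < r) (hrR : r < R) {n : ℤ} (hn : n < 0) :
    fourierCoeffOn two_pi_pos (fun θ ↦ f (circleMap c r θ)) n = 0 := by
  obtain ⟨k, hk⟩ := Int.eq_ofNat_of_zero_le (show 0 ≤ -(n + 1) by lia)
  have hcauchy : ∮ z in C(c, r), (z - c) ^ k • f z = 0 :=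
    DiffContOnCl.circleIntegral_eq_zero hr.le
      ((show DifferentiableOn ℂ (fun z ↦ (z - c) ^ k) (Metric.ball c R) by fun_prop).smul
        hf |>.diffContOnCl_ball (Metric.closedBall_subset_ball hrR))
  simp only [fourierCoeffOn_comp_circleMap hr.ne', hk, zpow_natCast, hcauchy, mul_zero]

lemma continuous_comp_circleMap (hf : ContinuousOn f (Metric.ball c R)) (hr : 0 < r)
    (hrR : r < R) : Continuous fun θ ↦ f (circleMap c r θ) :=
  hf.comp_continuous (continuous_circleMap c r) fun θ ↦ by simp [circleMap, abs_of_pos hr, hrR]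

theorem hasSum_integral_sq_norm_comp_circleMap (hf : DifferentiableOn ℂ f (Metric.ball c R))
    (hr : 0 < r) (hrR : r < R) :
    HasSum (fun n : ℕ ↦ 2 * π * (‖iteratedDeriv n f c‖ ^ 2 / (n.factorial : ℝ) ^ 2) * r ^ (2 * n))
      (∫ θ in -π..π, ‖f (circleMap c r θ)‖ ^ 2) := by
  have hcont := continuous_comp_circleMap hf.continuousOn hr hrR
  have hparseval := hasSum_sq_fourierCoeffOn two_pi_pos <|
    (memLp_two_iff_integrable_sq_norm hcont.aestronglyMeasurable).2
      (hcont.norm.pow 2).integrableOn_Ioc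
  rw [← Nat.cast_injective.hasSum_iff] at hparseval
  · have hshift := ((periodic_circleMap c r).comp fun z ↦ ‖f z‖ ^ 2).intervalIntegral_add_eq (-π) 0
    have hscaled := hparseval.mul_left (2 * π)
    rw [zero_add, show -π + 2 * π = π by ring] at hshift
    simp only [Function.comp_apply] at hshift
    rw [sub_zero, smul_eq_mul, mul_inv_cancel_left₀ two_pi_pos.ne', ← hshift] at hscaled
    refine hscaled.congr_fun fun n ↦ ?_
    rw [Function.comp_apply, fourierCoeffOn_comp_circleMap_natCast hf hr hrR]
    simp only [norm_mul, norm_pow, norm_inv, Complex.norm_real, Complex.norm_natCast,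
      norm_of_nonneg hr.le]
    ring
  · intro n hn
    rw [fourierCoeffOn_comp_circleMap_of_neg hf hr hrR, norm_zero, zero_pow two_ne_zero]
    by_contra! h
    exact hn ⟨n.toNat, by simp [h]⟩

theorem setLIntegral_sq_enorm_comp_circleMap (hf : DifferentiableOn ℂ f (Metric.ball c R))
    (hr : 0 < r) (hrR : r < R) :
    ∫⁻ θ in Ioo (-π) π, ‖f (circleMap c r θ)‖ₑ ^ 2 =
      ∑' n : ℕ, ENNReal.ofReal
        (2 * π * (‖iteratedDeriv n f c‖ ^ 2 / (n.factorial : ℝ) ^ 2) * r ^ (2 * n)) := by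
  have hcont := continuous_comp_circleMap hf.continuousOn hr hrR
  have hgutzmer := hasSum_integral_sq_norm_comp_circleMap hf hr hrR
  rw [← ENNReal.ofReal_tsum_of_nonneg (fun n ↦ by positivity) hgutzmer.summable, hgutzmer.tsum_eq,
    intervalIntegral.integral_of_le (by linarith [pi_pos]), integral_Ioc_eq_integral_Ioo,
    ofReal_integral_eq_lintegral_ofReal]
  · simp_rw [ENNReal.ofReal_pow (norm_nonneg _), ofReal_norm]
  · exact ((hcont.norm.pow 2).integrableOn_Ioc (a := -π) (b := π)).mono_set Ioo_subset_Ioc_self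
  · exact Eventually.of_forall fun θ ↦ by positivity

end Gutzmer

section RadialWeight

open Real

lemma lintegral_eq_lintegral_circleMap {F : ℂ → ℝ≥0∞} (hF : Measurable F) (c : ℂ) :
    ∫⁻ z, F z =
      ∫⁻ r in Ioi (0 : ℝ), ENNReal.ofReal r * ∫⁻ θ in Ioo (-π) π, F (circleMap c r θ) := by
  have hpolar : ∀ p : ℝ × ℝ, c + Complex.polarCoord.symm p = circleMap c p.1 p.2 := fun p ↦ by
    rw [Complex.polarCoord_symm_apply, circleMap, Complex.exp_mul_I]
    simp
  have hmeas : Measurable fun p : ℝ × ℝ ↦ circleMap c p.1 p.2 := by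
    unfold circleMap
    fun_prop
  rw [← lintegral_add_left_eq_self F c, ← Complex.lintegral_comp_polarCoord_symm,
    show polarCoord.target = Ioi (0 : ℝ) ×ˢ Ioo (-π) π from rfl, Measure.volume_eq_prod,
    setLIntegral_prod]
  · simp_rw [hpolar, smul_eq_mul, lintegral_const_mul' _ _ ENNReal.ofReal_ne_top]
  · simp_rw [hpolar]
    exact ((ENNReal.measurable_ofReal.comp measurable_fst).mul (hF.comp hmeas)).aemeasurable

lemma measurable_indicator_sq_enorm_mul {f : ℂ → ℂ} {s : Set ℂ} (hf : ContinuousOn f s)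
    (hs : MeasurableSet s) {w : ℂ → ℝ≥0∞} (hw : Measurable w) :
    Measurable (s.indicator fun z ↦ ‖f z‖ₑ ^ 2 * w z) := by
  classical
  have hfs : Measurable (s.indicator f) := by
    rw [← piecewise_eq_indicator]
    exact hf.measurable_piecewise continuousOn_const hs
  convert (hfs.enorm.pow_const 2).mul hw using 1
  ext z
  by_cases hz : z ∈ s <;> simp [hz]

variable {f : ℂ → ℂ} {c : ℂ} {R : ℝ} {w : ℝ → ℝ≥0∞}

lemma setLIntegral_indicator_ball_comp_circleMap (hf : DifferentiableOn ℂ f (Metric.ball c R))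
    {r : ℝ} (hr : 0 < r) :
    ENNReal.ofReal r * ∫⁻ θ in Ioo (-π) π,
        (Metric.ball c R).indicator (fun z ↦ ‖f z‖ₑ ^ 2 * w ‖z - c‖) (circleMap c r θ) =
      (Ioo 0 R).indicator (fun r ↦ ∑' n : ℕ,
        ENNReal.ofReal (2 * π * (‖iteratedDeriv n f c‖ ^ 2 / (n.factorial : ℝ) ^ 2)) *
          (ENNReal.ofReal (r ^ (2 * n + 1)) * w r)) r := by
  have hnorm : ∀ θ, ‖circleMap c r θ - c‖ = r := fun θ ↦ by simp [circleMap, abs_of_pos hr]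
  have hmem : ∀ θ, circleMap c r θ ∈ Metric.ball c R ↔ r ∈ Ioo 0 R := fun θ ↦ by
    rw [mem_ball_iff_norm, hnorm, mem_Ioo, and_iff_right hr]
  by_cases hrR : r ∈ Ioo 0 R
  · simp only [indicator_of_mem ((hmem _).2 hrR), indicator_of_mem hrR, hnorm]
    rw [lintegral_mul_const _
        ((continuous_comp_circleMap hf.continuousOn hr hrR.2).measurable.enorm.pow_const 2),
      setLIntegral_sq_enorm_comp_circleMap hf hr hrR.2, ← ENNReal.tsum_mul_right,
      ← ENNReal.tsum_mul_left]
    refine tsum_congr fun n ↦ ?_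
    rw [← mul_assoc, ← mul_assoc, ← ENNReal.ofReal_mul hr.le, ← ENNReal.ofReal_mul (by positivity)]
    ring_nf
  · simp only [indicator_of_notMem (mt (hmem _).1 hrR), indicator_of_notMem hrR, lintegral_zero,
      mul_zero]

theorem setLIntegral_ball_sq_enorm_mul_radial (hf : DifferentiableOn ℂ f (Metric.ball c R))
    (hw : Measurable w) :
    ∫⁻ z in Metric.ball c R, ‖f z‖ₑ ^ 2 * w ‖z - c‖ =
      ∑' n : ℕ, ENNReal.ofReal (2 * π * (‖iteratedDeriv n f c‖ ^ 2 / (n.factorial : ℝ) ^ 2)) *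
        ∫⁻ r in Ioo 0 R, ENNReal.ofReal (r ^ (2 * n + 1)) * w r := by
  have hmeas : Measurable ((Metric.ball c R).indicator fun z ↦ ‖f z‖ₑ ^ 2 * w ‖z - c‖) :=
    measurable_indicator_sq_enorm_mul hf.continuousOn measurableSet_ball
      (hw.comp (measurable_id.sub_const c).norm)
  rw [← lintegral_indicator measurableSet_ball, lintegral_eq_lintegral_circleMap hmeas c,
    setLIntegral_congr_fun measurableSet_Ioi
      fun r hr ↦ setLIntegral_indicator_ball_comp_circleMap hf hr,
    lintegral_indicator measurableSet_Ioo, Measure.restrict_restrict measurableSet_Ioo,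
    inter_eq_left.2 Ioo_subset_Ioi_self,
    lintegral_tsum fun n ↦ Measurable.aemeasurable (by fun_prop)]
  exact tsum_congr fun n ↦ lintegral_const_mul' _ _ ENNReal.ofReal_ne_top

end RadialWeight

section DiskKernel

open Real

/-- The disc about the point `x` of the real axis that touches the diagonals `|im z| = re z` of the
right half-plane. -/
noncomputable def armDisk (x : ℝ) : Set ℂ := Metric.ball (x : ℂ) (x / √2)

/-- The kernel `1 / (π √(x² - 2|z - x|²))`; outside `armDisk x`, it vanishes because of the
convention that `√t = 0` for `t ≤ 0` and `1 / 0 = 0`. -/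
noncomputable def diskKernel (x : ℝ) (z : ℂ) : ℝ≥0∞ :=
  ENNReal.ofReal ((π * √(x ^ 2 - 2 * ‖z - x‖ ^ 2))⁻¹)

variable {x : ℝ}

lemma isOpen_armDisk : IsOpen (armDisk x) := Metric.isOpen_ball

lemma ofReal_mem_armDisk (hx : 0 < x) : (x : ℂ) ∈ armDisk x := Metric.mem_ball_self (by positivity)

lemma mem_armDisk_iff (hx : 0 < x) {z : ℂ} : z ∈ armDisk x ↔ 2 * ‖z - x‖ ^ 2 < x ^ 2 := by
  rw [armDisk, mem_ball_iff_norm, lt_div_iff₀ (by positivity),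
    ← pow_lt_pow_iff_left₀ (by positivity) hx.le two_ne_zero, mul_pow, sq_sqrt zero_le_two,
    mul_comm]

lemma sq_norm_sub_ofReal (z : ℂ) (x : ℝ) : ‖z - x‖ ^ 2 = (z.re - x) ^ 2 + z.im ^ 2 := by
  rw [← Complex.normSq_eq_norm_sq, Complex.normSq_apply]
  simp only [Complex.sub_re, Complex.sub_im, Complex.ofReal_re, Complex.ofReal_im]
  ring

lemma measurable_diskKernel : Measurable (Function.uncurry diskKernel) := by
  unfold diskKernel Function.uncurry
  fun_prop

lemma diskKernel_eq_arcsine (x : ℝ) (z : ℂ) : diskKernel x z = ENNReal.ofReal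
    ((π * √(2 * (z.re ^ 2 - z.im ^ 2) - (x - 2 * z.re) ^ 2))⁻¹) := by
  rw [diskKernel, sq_norm_sub_ofReal]
  ring_nf

lemma diskKernel_eq_zero (hx : 0 < x) {z : ℂ} (hz : z ∉ armDisk x) : diskKernel x z = 0 := by
  rw [mem_armDisk_iff hx, not_lt] at hz
  rw [diskKernel, sqrt_eq_zero_of_nonpos (by linarith), mul_zero, inv_zero, ENNReal.ofReal_zero]

lemma lintegral_pow_mul_radial_diskKernel (hx : 0 < x) (n : ℕ) :
    ∫⁻ r in Ioo 0 (x / √2),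
        ENNReal.ofReal (r ^ (2 * n + 1)) * ENNReal.ofReal ((π * √(x ^ 2 - 2 * r ^ 2))⁻¹) =
      ENNReal.ofReal (2 ^ n * (n.factorial : ℝ) ^ 2 / (2 * π * (2 * n + 1).factorial) *
        x ^ (2 * n + 1)) := by
  obtain ⟨s, hs, rfl⟩ : ∃ s, 0 < s ∧ x = s * √2 := ⟨x / √2, by positivity, by field_simp⟩
  have hintegrand : EqOn
      (fun r ↦ ENNReal.ofReal (r ^ (2 * n + 1)) *
        ENNReal.ofReal ((π * √((s * √2) ^ 2 - 2 * r ^ 2))⁻¹))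
      (fun r ↦ ENNReal.ofReal ((π * √2)⁻¹) *
        ENNReal.ofReal (r ^ (2 * n + 1) * (√(s ^ 2 - r ^ 2))⁻¹)) (Ioo 0 s) := by
    intro r hr
    have hr0 : 0 < r := hr.1
    simp only
    rw [← ENNReal.ofReal_mul (by positivity), ← ENNReal.ofReal_mul (by positivity), mul_pow,
      sq_sqrt zero_le_two, mul_comm (s ^ 2), ← mul_sub, sqrt_mul zero_le_two]
    congr 1
    simp only [mul_inv]
    ring
  rw [mul_div_cancel_right₀ _ (by positivity), setLIntegral_congr_fun measurableSet_Ioo hintegrand,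
    lintegral_const_mul' _ _ ENNReal.ofReal_ne_top, lintegral_pow_mul_inv_sqrt_sq_sub_sq hs,
    ← ENNReal.ofReal_mul (by positivity)]
  congr 1
  have hsqrt : √2 ^ (2 * n + 2) = 2 ^ n * 2 := by
    rw [show 2 * n + 2 = 2 * (n + 1) by ring, pow_mul, sq_sqrt zero_le_two, pow_succ]
  have hfour : (4 : ℝ) ^ n = 2 ^ n * 2 ^ n := by rw [← mul_pow]; norm_num
  rw [mul_pow, hfour]
  field_simp
  linear_combination (-1 : ℝ) * hsqrt

theorem setLIntegral_armDisk_sq_enorm_mul_diskKernel {f : ℂ → ℂ} (hx : 0 < x)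
    (hf : DifferentiableOn ℂ f (armDisk x)) :
    ∫⁻ z in armDisk x, ‖f z‖ₑ ^ 2 * diskKernel x z =
      ∑' n : ℕ, ENNReal.ofReal (2 ^ n / ((2 * n + 1).factorial : ℝ)) *
        ENNReal.ofReal (x ^ (2 * n + 1) * ‖iteratedDeriv n f x‖ ^ 2) := by
  rw [armDisk]
  simp only [diskKernel]
  rw [setLIntegral_ball_sq_enorm_mul_radial hf
    (w := fun r ↦ ENNReal.ofReal ((π * √(x ^ 2 - 2 * r ^ 2))⁻¹)) (by fun_prop)]
  refine tsum_congr fun n ↦ ?_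
  rw [lintegral_pow_mul_radial_diskKernel hx, ← ENNReal.ofReal_mul (by positivity),
    ← ENNReal.ofReal_mul (by positivity)]
  congr 1
  field_simp

end DiskKernel

section ArmSum

open Real

/-- The contribution to `S(f)` of one half of a diagonal of a square with half-diagonal `L`, where
`h x` is the value of `f` at distance `x` from the vertex. -/
noncomputable def armSum (L : ℝ) (h : ℝ → ℂ) : ℝ≥0∞ :=
  ∑' n : ℕ, ENNReal.ofReal (2 ^ n / ((2 * n + 1).factorial : ℝ)) *
    ∫⁻ x in Ioo 0 L, ENNReal.ofReal (x ^ (2 * n + 1) * ‖iteratedDeriv n h x‖ ^ 2)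

/-- The union of the discs `armDisk x` about the points of the arm `(0, L)`, on which the values
on the arm determine a holomorphic function of finite arm sum. -/
noncomputable def armRegion (L : ℝ) : Set ℂ := ⋃ x ∈ Ioo 0 L, armDisk x

/-- The total mass at `z` of the kernels `diskKernel x` with `x` on the arm. -/
noncomputable def armWeight (L : ℝ) (z : ℂ) : ℝ≥0∞ := ∫⁻ x in Ioo 0 L, diskKernel x z

/-- The quarter, adjacent to the vertex `0`, of the square with centre `L` and vertices `0`, `2L`
and `L ± iL`. -/
def quarter (L : ℝ) : Set ℂ := {z | |z.im| < z.re ∧ z.re + |z.im| ≤ L}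

variable {L : ℝ} {f : ℂ → ℂ} {h : ℝ → ℂ}

lemma isOpen_armRegion : IsOpen (armRegion L) := isOpen_biUnion fun _ _ ↦ isOpen_armDisk

lemma armDisk_subset_armRegion {x : ℝ} (hx : x ∈ Ioo 0 L) : armDisk x ⊆ armRegion L :=
  subset_biUnion_of_mem hx

lemma ofReal_mem_armRegion {x : ℝ} (hx : x ∈ Ioo 0 L) : (x : ℂ) ∈ armRegion L :=
  armDisk_subset_armRegion hx (ofReal_mem_armDisk hx.1)

lemma measurableSet_quarter : MeasurableSet (quarter L) :=
  .inter (measurableSet_lt Complex.measurable_im.abs Complex.measurable_re)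
    (measurableSet_le (Complex.measurable_re.add Complex.measurable_im.abs) measurable_const)

lemma armWeight_le_one (L : ℝ) (z : ℂ) : armWeight L z ≤ 1 := by
  refine (setLIntegral_le_lintegral _ _).trans ?_
  simp only [diskKernel_eq_arcsine]
  exact lintegral_arcsine_le_one _ _

lemma one_fourth_le_armWeight {z : ℂ} (hz : z ∈ quarter L) : 1 / 4 ≤ armWeight L z := by
  obtain ⟨him, hre⟩ := hz
  have him0 := abs_nonneg z.im
  have hq : 0 < 2 * (z.re ^ 2 - z.im ^ 2) := by
    rw [← sq_abs z.im]
    nlinarith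
  set s := √(2 * (z.re ^ 2 - z.im ^ 2))
  have hs : 0 < s := sqrt_pos.2 hq
  have hs_sq : s ^ 2 = 2 * (z.re ^ 2 - z.im ^ 2) := sq_sqrt hq.le
  have hlower : s ≤ 2 * z.re := le_of_sq_le_sq (by nlinarith [sq_nonneg z.im]) (by linarith)
  have hupper : 2 * z.re - L ≤ s * (√2 / 2) := by
    rcases le_or_gt (2 * z.re) L with hL | hL
    · have : 0 < s * (√2 / 2) := by positivity
      linarith
    · refine le_of_sq_le_sq ?_ (by positivity)
      rw [mul_pow, div_pow, sq_sqrt zero_le_two, hs_sq, ← sq_abs z.im]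
      nlinarith
  have harc := setLIntegral_arcsine (2 * z.re) hs le_rfl
    (show -(π / 4) ≤ π / 2 by linarith [pi_pos]) (by linarith [pi_pos])
  simp only [sin_neg, sin_pi_div_two, sin_pi_div_four, hs_sq, ← diskKernel_eq_arcsine] at harc
  calc (1 / 4 : ℝ≥0∞) = ENNReal.ofReal ((-(π / 4) - -(π / 2)) / π) := by
        rw [show (-(π / 4) - -(π / 2)) / π = 1 / 4 by field_simp; norm_num,
          ENNReal.ofReal_div_of_pos (by norm_num)]
        simp
    _ = ∫⁻ x in Ioo (2 * z.re + s * -1) (2 * z.re + s * -(√2 / 2)), diskKernel x z := harc.symm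
    _ ≤ armWeight L z := lintegral_mono_set (Ioo_subset_Ioo (by linarith) (by linarith))

lemma quarter_subset_armRegion : quarter L ⊆ armRegion L := by
  intro z hz
  by_contra hzL
  have hzero : armWeight L z = 0 := by
    rw [armWeight, setLIntegral_congr_fun (g := 0) measurableSet_Ioo fun x hx ↦
      diskKernel_eq_zero hx.1 fun hzx ↦ hzL (armDisk_subset_armRegion hx hzx)]
    simp
  have hpos := one_fourth_le_armWeight hz
  simp [hzero] at hpos

lemma continuousOn_iteratedDeriv_of_isOpen {s : Set ℝ} (hs : IsOpen s) (hh : ContDiffOn ℝ ∞ h s)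
    (n : ℕ) : ContinuousOn (iteratedDeriv n h) s :=
  (hh.continuousOn_iteratedDerivWithin (mod_cast le_top) hs.uniqueDiffOn).congr fun _ hx ↦
    (iteratedDerivWithin_of_isOpen hs hx).symm

lemma armSum_eq_lintegral_tsum (hh : ContDiffOn ℝ ∞ h (Ioo 0 L)) :
    armSum L h = ∫⁻ x in Ioo 0 L, ∑' n : ℕ, ENNReal.ofReal (2 ^ n / ((2 * n + 1).factorial : ℝ)) *
      ENNReal.ofReal (x ^ (2 * n + 1) * ‖iteratedDeriv n h x‖ ^ 2) := by
  rw [lintegral_tsum]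
  · exact tsum_congr fun n ↦ (lintegral_const_mul' _ _ ENNReal.ofReal_ne_top).symm
  · intro n
    have hcont := continuousOn_iteratedDeriv_of_isOpen isOpen_Ioo hh n
    exact (ContinuousOn.aemeasurable (by fun_prop) measurableSet_Ioo).ennreal_ofReal.const_mul _

lemma armSum_congr {h₁ h₂ : ℝ → ℂ} (hh : EqOn h₁ h₂ (Ioo 0 L)) : armSum L h₁ = armSum L h₂ := by
  refine tsum_congr fun n ↦ congrArg _ (setLIntegral_congr_fun measurableSet_Ioo fun x hx ↦ ?_)
  simp only [hh.iteratedDeriv_of_isOpen isOpen_Ioo n hx]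

lemma iteratedDeriv_comp_affine {U : Set ℂ} (hU : IsOpen U) (hf : DifferentiableOn ℂ f U) (c a : ℂ)
    (n : ℕ) {t : ℝ} (ht : c + a * t ∈ U) :
    iteratedDeriv n (fun t : ℝ ↦ f (c + a * t)) t = a ^ n * iteratedDeriv n f (c + a * t) := by
  induction n generalizing t with
  | zero => simp
  | succ n ih =>
    have hline : HasDerivAt (fun t : ℝ ↦ c + a * t) a t := by
      simpa using ((Complex.ofRealCLM.hasDerivAt (x := t)).const_mul a).const_add c
    have hnear : iteratedDeriv n (fun t : ℝ ↦ f (c + a * t)) =ᶠ[𝓝 t]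
        fun t : ℝ ↦ a ^ n * iteratedDeriv n f (c + a * t) := by
      filter_upwards [hline.continuousAt.preimage_mem_nhds (hU.mem_nhds ht)] with y hy using ih hy
    have hf_n : DifferentiableAt ℂ (iteratedDeriv n f) (c + a * t) := by
      rw [iteratedDeriv_eq_iterate]
      exact ((hf.analyticAt (hU.mem_nhds ht)).iterated_deriv n).differentiableAt
    have hchain : HasDerivAt (fun t : ℝ ↦ iteratedDeriv n f (c + a * t))
        (deriv (iteratedDeriv n f) (c + a * t) * a) t :=
      hf_n.hasDerivAt.comp_of_eq t hline rfl
    rw [iteratedDeriv_succ, iteratedDeriv_succ, hnear.deriv_eq, (hchain.const_mul _).deriv]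
    ring

lemma contDiffOn_comp_affine {U : Set ℂ} (hU : IsOpen U) (hf : DifferentiableOn ℂ f U) (c a : ℂ)
    {s : Set ℝ} (hs : ∀ t ∈ s, c + a * t ∈ U) : ContDiffOn ℝ ∞ (fun t : ℝ ↦ f (c + a * t)) s := by
  have hline : ContDiff ℝ ∞ fun t : ℝ ↦ c + a * t :=
    contDiff_const.add (contDiff_const.mul Complex.ofRealCLM.contDiff)
  exact ((hf.contDiffOn hU).restrict_scalars ℝ).comp hline.contDiffOn hs

lemma tsum_iteratedDeriv_eq_lintegral_diskKernel (hf : DifferentiableOn ℂ f (armRegion L)) {x : ℝ}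
    (hx : x ∈ Ioo 0 L) :
    ∑' n : ℕ, ENNReal.ofReal (2 ^ n / ((2 * n + 1).factorial : ℝ)) *
        ENNReal.ofReal (x ^ (2 * n + 1) * ‖iteratedDeriv n (fun x : ℝ ↦ f x) x‖ ^ 2) =
      ∫⁻ z, (armRegion L).indicator (fun z ↦ ‖f z‖ₑ ^ 2) z * diskKernel x z := by
  have hderiv : ∀ n, iteratedDeriv n (fun x : ℝ ↦ f x) x = iteratedDeriv n f x := fun n ↦ by
    simpa using iteratedDeriv_comp_affine isOpen_armRegion hf 0 1 n
      (by simpa using ofReal_mem_armRegion hx)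
  simp only [hderiv]
  rw [← setLIntegral_armDisk_sq_enorm_mul_diskKernel hx.1 (hf.mono (armDisk_subset_armRegion hx)),
    ← lintegral_indicator isOpen_armDisk.measurableSet]
  refine lintegral_congr fun z ↦ ?_
  by_cases hz : z ∈ armDisk x
  · rw [indicator_of_mem hz, indicator_of_mem (armDisk_subset_armRegion hx hz)]
  · rw [indicator_of_notMem hz, diskKernel_eq_zero hx.1 hz, mul_zero]

theorem armSum_eq_setLIntegral (hf : DifferentiableOn ℂ f (armRegion L)) :
    armSum L (fun x ↦ f x) = ∫⁻ z in armRegion L, ‖f z‖ₑ ^ 2 * armWeight L z := by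
  have hmeas : Measurable ((armRegion L).indicator fun z ↦ ‖f z‖ₑ ^ 2) := by
    simpa using measurable_indicator_sq_enorm_mul hf.continuousOn isOpen_armRegion.measurableSet
      measurable_const (w := fun _ ↦ 1)
  have hreal : ContDiffOn ℝ ∞ (fun x : ℝ ↦ f x) (Ioo 0 L) := by
    simpa using contDiffOn_comp_affine isOpen_armRegion hf 0 1 fun x hx ↦ by
      simpa using ofReal_mem_armRegion hx
  rw [armSum_eq_lintegral_tsum hreal, setLIntegral_congr_fun measurableSet_Ioo
      fun x hx ↦ tsum_iteratedDeriv_eq_lintegral_diskKernel hf hx,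
    lintegral_lintegral_swap ((hmeas.comp measurable_snd).mul measurable_diskKernel).aemeasurable,
    ← lintegral_indicator isOpen_armRegion.measurableSet]
  refine lintegral_congr fun z ↦ ?_
  rw [indicator_mul_left, lintegral_const_mul _ measurable_diskKernel.of_uncurry_right]
  rfl

lemma armSum_le_setLIntegral (hf : DifferentiableOn ℂ f (armRegion L)) :
    armSum L (fun x ↦ f x) ≤ ∫⁻ z in armRegion L, ‖f z‖ₑ ^ 2 := by
  rw [armSum_eq_setLIntegral hf]
  exact lintegral_mono fun z ↦ mul_le_of_le_one_right' (armWeight_le_one L z)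

lemma setLIntegral_quarter_le_armSum (hf : DifferentiableOn ℂ f (armRegion L)) :
    1 / 4 * ∫⁻ z in quarter L, ‖f z‖ₑ ^ 2 ≤ armSum L (fun x ↦ f x) := by
  rw [armSum_eq_setLIntegral hf, ← lintegral_const_mul' _ _ (by simp)]
  refine (setLIntegral_mono' measurableSet_quarter fun z hz ↦ ?_).trans
    (lintegral_mono_set quarter_subset_armRegion)
  rw [mul_comm]
  gcongr
  exact one_fourth_le_armWeight hz

end ArmSum

section DerivativeBounds

lemma sq_norm_le_integral_sq_norm_add {E : Type*} [NormedAddCommGroup E] [InnerProductSpace ℝ E]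
    {v v' : ℝ → E} {a b t : ℝ} (hab : a < b) (hv : ∀ x ∈ Icc a b, HasDerivAt v (v' x) x)
    (hv' : ContinuousOn v' (Icc a b)) (ht : t ∈ Icc a b) :
    ‖v t‖ ^ 2 ≤ (1 + (b - a)⁻¹) * (∫ x in a..b, ‖v x‖ ^ 2) + ∫ x in a..b, ‖v' x‖ ^ 2 := by
  have hcont : ContinuousOn v (Icc a b) := fun x hx ↦ (hv x hx).continuousAt.continuousWithinAt
  have hint : IntervalIntegrable (fun x ↦ ‖v x‖ ^ 2) volume a b :=
    (hcont.norm.pow 2).intervalIntegrable_of_Icc hab.le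
  have hint' : IntervalIntegrable (fun x ↦ ‖v' x‖ ^ 2) volume a b :=
    (hv'.norm.pow 2).intervalIntegrable_of_Icc hab.le
  obtain ⟨s, hs, hs_le⟩ : ∃ s ∈ Icc a b, ‖v s‖ ^ 2 ≤ (b - a)⁻¹ * ∫ x in a..b, ‖v x‖ ^ 2 := by
    obtain ⟨s, hs, hs_le⟩ := exists_le_setAverage (μ := volume) (by simp [hab]) (by simp)
      (hcont.norm.pow 2).integrableOn_Icc
    refine ⟨s, hs, hs_le.trans_eq ?_⟩
    rw [setAverage_eq, integral_Icc_eq_integral_Ioc, ← intervalIntegral.integral_of_le hab.le]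
    simp [hab.le]
  have hst : uIcc s t ⊆ Icc a b := by
    rw [← uIcc_of_le hab.le] at hs ht ⊢
    exact uIcc_subset_uIcc hs ht
  have hftc : ∫ x in s..t, 2 * inner ℝ (v x) (v' x) = ‖v t‖ ^ 2 - ‖v s‖ ^ 2 :=
    intervalIntegral.integral_eq_sub_of_hasDerivAt (fun x hx ↦ (hv x (hst hx)).norm_sq)
      (((hcont.inner hv' (𝕜 := ℝ)).const_mul 2).mono hst).intervalIntegrable
  have hgrowth : ‖v t‖ ^ 2 - ‖v s‖ ^ 2 ≤ ∫ x in a..b, (‖v x‖ ^ 2 + ‖v' x‖ ^ 2) := by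
    rw [← hftc, intervalIntegral.integral_of_le hab.le]
    have hsum : IntegrableOn (fun x ↦ ‖v x‖ ^ 2 + ‖v' x‖ ^ 2) (Ioc a b) := (hint.add hint').1
    have hst' : uIoc s t ⊆ Ioc a b := Ioc_subset_Ioc (le_min hs.1 ht.1) (max_le hs.2 ht.2)
    calc ∫ x in s..t, 2 * inner ℝ (v x) (v' x)
        ≤ ∫ x in uIoc s t, ‖2 * inner ℝ (v x) (v' x)‖ :=
          (Real.le_norm_self _).trans intervalIntegral.norm_integral_le_integral_norm_uIoc
      _ ≤ ∫ x in uIoc s t, (‖v x‖ ^ 2 + ‖v' x‖ ^ 2) := by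
          refine integral_mono_of_nonneg (Eventually.of_forall fun x ↦ norm_nonneg _)
            (hsum.mono_set hst') (Eventually.of_forall fun x ↦ ?_)
          simp only [norm_mul, Real.norm_ofNat]
          nlinarith [norm_inner_le_norm (𝕜 := ℝ) (v x) (v' x), sq_nonneg (‖v x‖ - ‖v' x‖)]
      _ ≤ ∫ x in Ioc a b, (‖v x‖ ^ 2 + ‖v' x‖ ^ 2) :=
          setIntegral_mono_set hsum (Eventually.of_forall fun x ↦ by positivity)
            hst'.eventuallyLE
  rw [intervalIntegral.integral_add hint hint'] at hgrowth
  linarith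

lemma factorial_two_mul_add_one_le (n : ℕ) :
    ((2 * n + 1).factorial : ℝ) ≤ (2 * n + 1) * 4 ^ n * (n.factorial : ℝ) ^ 2 := by
  have hcentral : (2 * n).factorial ≤ 4 ^ n * n.factorial ^ 2 := by
    have hchoose := Nat.choose_mul_factorial_mul_factorial (show n ≤ 2 * n by omega)
    rw [show 2 * n - n = n by omega, mul_assoc, ← sq] at hchoose
    rw [← hchoose, show (4 : ℕ) = 2 ^ 2 by rfl, ← pow_mul]
    gcongr
    exact Nat.choose_le_two_pow _ _
  rw [Nat.factorial_succ, mul_assoc]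
  exact_mod_cast Nat.mul_le_mul_left _ hcentral

lemma factorial_two_mul_add_one_div_le {a : ℝ} (ha : 0 < a) (n : ℕ) :
    (2 * n + 1).factorial / (2 ^ n * a ^ (2 * n + 1)) ≤
      (2 * n + 1) * (n.factorial : ℝ) ^ 2 * (2 / a ^ 2) ^ n / a := by
  rw [div_le_iff₀ (by positivity)]
  refine (factorial_two_mul_add_one_le n).trans_eq ?_
  rw [div_pow, ← pow_mul, show (4 : ℝ) = 2 * 2 by norm_num, mul_pow]
  field_simp
  ring

lemma factorial_two_mul_add_three_div_le {a : ℝ} (ha : 0 < a) (n : ℕ) :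
    (2 * (n + 1) + 1).factorial / (2 ^ (n + 1) * a ^ (2 * (n + 1) + 1)) ≤
      (2 * n + 3) ^ 3 * (n.factorial : ℝ) ^ 2 * (2 / a ^ 2) ^ n / a ^ 3 := by
  refine (factorial_two_mul_add_one_div_le ha (n + 1)).trans ?_
  rw [Nat.factorial_succ, pow_succ (2 / a ^ 2)]
  push_cast
  calc (2 * (n + 1) + 1) * ((n + 1) * (n.factorial : ℝ)) ^ 2 * ((2 / a ^ 2) ^ n * (2 / a ^ 2)) / a
      = (2 * n + 3) * (2 * (n + 1) ^ 2) * (n.factorial : ℝ) ^ 2 * (2 / a ^ 2) ^ n / a ^ 3 := by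
        field_simp
        ring
    _ ≤ (2 * n + 3) * (2 * n + 3) ^ 2 * (n.factorial : ℝ) ^ 2 * (2 / a ^ 2) ^ n / a ^ 3 := by
        gcongr
        nlinarith [(n.cast_nonneg : (0 : ℝ) ≤ n)]
    _ = _ := by ring

lemma exists_forall_two_mul_add_three_pow_mul_pow_le {q : ℝ} (hq : 0 < q) (hq1 : q < 1) (k : ℕ) :
    ∃ B, ∀ n : ℕ, (2 * n + 3 : ℝ) ^ k * q ^ n ≤ B := by
  obtain ⟨B, hB⟩ := (tendsto_pow_const_mul_const_pow_of_lt_one k hq.le hq1).bddAbove_range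
  refine ⟨3 ^ k * B / q, fun n ↦ ?_⟩
  have hn : ((n + 1 : ℕ) : ℝ) ^ k * q ^ (n + 1) ≤ B := hB (mem_range_self (n + 1))
  rw [le_div_iff₀ hq, mul_assoc, ← pow_succ]
  calc (2 * n + 3 : ℝ) ^ k * q ^ (n + 1) ≤ (3 * (n + 1 : ℕ)) ^ k * q ^ (n + 1) := by
        gcongr
        push_cast
        linarith [(n.cast_nonneg : (0 : ℝ) ≤ n)]
    _ ≤ 3 ^ k * B := by
        rw [mul_pow, mul_assoc]
        gcongr

variable {L : ℝ} {h : ℝ → ℂ} {a b : ℝ}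

lemma integral_sq_norm_iteratedDeriv_le (hh : ContDiffOn ℝ ∞ h (Ioo 0 L)) (hfin : armSum L h < ⊤)
    (ha : 0 < a) (hab : a ≤ b) (hb : b < L) (n : ℕ) :
    ∫ x in a..b, ‖iteratedDeriv n h x‖ ^ 2 ≤
      (armSum L h).toReal * ((2 * n + 1).factorial / (2 ^ n * a ^ (2 * n + 1))) := by
  have hcont : ContinuousOn (iteratedDeriv n h) (Icc a b) :=
    (continuousOn_iteratedDeriv_of_isOpen isOpen_Ioo hh n).mono (Icc_subset_Ioo ha hb)
  have hterm : ENNReal.ofReal (2 ^ n / ((2 * n + 1).factorial : ℝ)) *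
      ∫⁻ x in Ioc a b, ENNReal.ofReal (a ^ (2 * n + 1) * ‖iteratedDeriv n h x‖ ^ 2) ≤
      armSum L h := by
    refine le_trans ?_ (ENNReal.le_tsum n)
    gcongr _ * ?_
    refine (setLIntegral_mono' measurableSet_Ioc fun x hx ↦ ?_).trans (lintegral_mono_set
      (Ioc_subset_Icc_self.trans (Icc_subset_Ioo ha hb)))
    have := hx.1.le
    gcongr
  rw [← ofReal_integral_eq_lintegral_ofReal, ← ENNReal.ofReal_mul (by positivity),
    ENNReal.ofReal_le_iff_le_toReal hfin.ne, integral_const_mul,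
    ← intervalIntegral.integral_of_le hab] at hterm
  · rw [mul_div_assoc', le_div_iff₀ (by positivity)]
    rw [div_mul_eq_mul_div, div_le_iff₀ (by positivity)] at hterm
    linarith
  · exact ((hcont.norm.pow 2).const_mul _).integrableOn_Icc.mono_set Ioc_subset_Icc_self
  · exact Eventually.of_forall fun x ↦ by positivity

lemma hasDerivAt_iteratedDeriv (hh : ContDiffOn ℝ ∞ h (Ioo 0 L)) (n : ℕ) {x : ℝ}
    (hx : x ∈ Ioo 0 L) : HasDerivAt (iteratedDeriv n h) (iteratedDeriv (n + 1) h x) x := by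
  rw [iteratedDeriv_succ]
  have hdiff := (hh.differentiableOn_iteratedDerivWithin (m := n)
    (mod_cast WithTop.coe_lt_top _) isOpen_Ioo.uniqueDiffOn).congr fun y hy ↦
      (iteratedDerivWithin_of_isOpen isOpen_Ioo hy).symm
  exact (hdiff.differentiableAt (isOpen_Ioo.mem_nhds hx)).hasDerivAt

lemma exists_forall_sq_norm_iteratedDeriv_le (hh : ContDiffOn ℝ ∞ h (Ioo 0 L))
    (hfin : armSum L h < ⊤) (ha : 0 < a) (hab : a < b) (hb : b < L) :
    ∃ K, 0 ≤ K ∧ ∀ n, ∀ t ∈ Icc a b, ‖iteratedDeriv n h t‖ ^ 2 ≤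
      K * ((2 * n + 3) ^ 3 * (n.factorial : ℝ) ^ 2 * (2 / a ^ 2) ^ n) := by
  have hsub := Icc_subset_Ioo ha hb
  have := sub_pos.2 hab
  set A := (armSum L h).toReal
  have hA : 0 ≤ A := ENNReal.toReal_nonneg
  refine ⟨(1 + (b - a)⁻¹) * A / a + A / a ^ 3, by positivity, fun n t ht ↦ ?_⟩
  have hsobolev := sq_norm_le_integral_sq_norm_add hab
    (fun x hx ↦ hasDerivAt_iteratedDeriv hh n (hsub hx))
    ((continuousOn_iteratedDeriv_of_isOpen isOpen_Ioo hh (n + 1)).mono hsub) ht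
  have hint := integral_sq_norm_iteratedDeriv_le hh hfin ha hab.le hb n
  have hint' := integral_sq_norm_iteratedDeriv_le hh hfin ha hab.le hb (n + 1)
  have hfac : (2 * n + 1).factorial / (2 ^ n * a ^ (2 * n + 1)) ≤
      (2 * n + 3) ^ 3 * (n.factorial : ℝ) ^ 2 * (2 / a ^ 2) ^ n / a := by
    refine (factorial_two_mul_add_one_div_le ha n).trans ?_
    gcongr
    nlinarith [sq_nonneg (n : ℝ)]
  have hfac' := factorial_two_mul_add_three_div_le ha n
  calc ‖iteratedDeriv n h t‖ ^ 2 ≤ _ := hsobolev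
    _ ≤ (1 + (b - a)⁻¹) * (A * _) + A * _ :=
      add_le_add (mul_le_mul_of_nonneg_left (hint.trans (mul_le_mul_of_nonneg_left hfac hA))
        (by positivity)) (hint'.trans (mul_le_mul_of_nonneg_left hfac' hA))
    _ = _ := by ring

theorem exists_forall_norm_iteratedDeriv_mul_pow_le (hh : ContDiffOn ℝ ∞ h (Ioo 0 L))
    (hfin : armSum L h < ⊤) (ha : 0 < a) (hab : a < b) (hb : b < L) {ρ : ℝ} (hρ : 0 < ρ)
    (hρa : ρ < a / √2) :
    ∃ C, ∀ n, ∀ t ∈ Icc a b, ‖iteratedDeriv n h t‖ * ρ ^ n ≤ C * n.factorial := by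
  have hq : 2 * ρ ^ 2 / a ^ 2 < 1 := by
    rw [lt_div_iff₀ (by positivity)] at hρa
    rw [div_lt_one (by positivity)]
    calc 2 * ρ ^ 2 = (ρ * √2) ^ 2 := by rw [mul_pow, Real.sq_sqrt zero_le_two, mul_comm]
      _ < a ^ 2 := by gcongr
  obtain ⟨B, hB⟩ := exists_forall_two_mul_add_three_pow_mul_pow_le (q := 2 * ρ ^ 2 / a ^ 2)
    (by positivity) hq 3
  obtain ⟨K, hK, hK_le⟩ := exists_forall_sq_norm_iteratedDeriv_le hh hfin ha hab hb
  have hKB : 0 ≤ K * B := mul_nonneg hK ((hB 0).trans' (by positivity))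
  refine ⟨√(K * B), fun n t ht ↦ le_of_sq_le_sq ?_ (by positivity)⟩
  calc (‖iteratedDeriv n h t‖ * ρ ^ n) ^ 2
      ≤ K * ((2 * n + 3) ^ 3 * (n.factorial : ℝ) ^ 2 * (2 / a ^ 2) ^ n) * (ρ ^ n) ^ 2 := by
        rw [mul_pow]
        gcongr
        exact hK_le n t ht
    _ = K * ((2 * n + 3) ^ 3 * (2 * ρ ^ 2 / a ^ 2) ^ n) * (n.factorial : ℝ) ^ 2 := by
        rw [mul_div_right_comm, mul_pow]
        ring
    _ ≤ K * B * (n.factorial : ℝ) ^ 2 := by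
        gcongr
        exact hB n
    _ = (√(K * B) * n.factorial) ^ 2 := by
        rw [mul_pow, Real.sq_sqrt hKB]

end DerivativeBounds

section Extension

open FormalMultilinearSeries

lemma exists_differentiableOn_iUnion_of_eqOn {ι 𝕜 E F : Type*} [NontriviallyNormedField 𝕜]
    [NormedAddCommGroup E] [NormedSpace 𝕜 E] [NormedAddCommGroup F] [NormedSpace 𝕜 F]
    {s : ι → Set E} {f : ι → E → F} (hs : ∀ i, IsOpen (s i))
    (hf : ∀ i, DifferentiableOn 𝕜 (f i) (s i))
    (hcompat : ∀ i j, EqOn (f i) (f j) (s i ∩ s j)) :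
    ∃ g : E → F, DifferentiableOn 𝕜 g (⋃ i, s i) ∧ ∀ i, EqOn g (f i) (s i) := by
  classical
  let g : E → F := fun z ↦ if hz : ∃ i, z ∈ s i then f hz.choose z else 0
  have hg : ∀ i, EqOn g (f i) (s i) := fun i z hz ↦ by
    have hex : ∃ i, z ∈ s i := ⟨i, hz⟩
    simp only [g, dif_pos hex]
    exact hcompat _ _ ⟨hex.choose_spec, hz⟩
  refine ⟨g, fun z hz ↦ ?_, hg⟩
  obtain ⟨i, hi⟩ := mem_iUnion.1 hz
  exact (((hf i).congr (hg i)).differentiableAt ((hs i).mem_nhds hi)).differentiableWithinAt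

lemma tendsto_taylorWithinEval_of_norm_iteratedDeriv_mul_pow_le {E : Type*} [NormedAddCommGroup E]
    [NormedSpace ℝ E] {g : ℝ → E} {a b ρ C y : ℝ} (hab : a < b)
    (hg : ∀ t ∈ Icc a b, ContDiffAt ℝ ∞ g t) (hρ : 0 < ρ)
    (hC : ∀ n, ∀ t ∈ Icc a b, ‖iteratedDeriv n g t‖ * ρ ^ n ≤ C * n.factorial)
    (hy : y ∈ Icc a b) (hyρ : y - a < ρ) :
    Tendsto (fun n ↦ taylorWithinEval g n (Icc a b) a y) atTop (𝓝 (g y)) := by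
  have hrem : ∀ n : ℕ, ‖g y - taylorWithinEval g n (Icc a b) a y‖ ≤
      C * ((n + 1 : ℕ) * ((y - a) / ρ) ^ (n + 1)) := fun n ↦ by
    have hbound := taylor_mean_remainder_bound (n := n) (C := C * (n + 1).factorial / ρ ^ (n + 1))
      hab.le (fun t ht ↦ ((hg t ht).of_le (mod_cast le_top)).contDiffWithinAt) hy fun t ht ↦ by
        rw [iteratedDerivWithin_eq_iteratedDeriv (uniqueDiffOn_Icc hab)
          ((hg t ht).of_le (mod_cast le_top)) ht, le_div_iff₀ (by positivity)]
        exact hC (n + 1) t ht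
    refine hbound.trans_eq ?_
    rw [Nat.factorial_succ, div_pow]
    push_cast
    field_simp
  have hq0 : 0 ≤ (y - a) / ρ := div_nonneg (sub_nonneg.2 hy.1) hρ.le
  have hq1 : (y - a) / ρ < 1 := (div_lt_one hρ).2 hyρ
  have hlim := ((tendsto_self_mul_const_pow_of_lt_one hq0 hq1).comp
    (tendsto_add_atTop_nat 1)).const_mul C
  rw [mul_zero] at hlim
  rw [tendsto_iff_norm_sub_tendsto_zero]
  exact squeeze_zero (fun n ↦ norm_nonneg _) (fun n ↦ (norm_sub_rev _ _).trans_le (hrem n)) hlim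

lemma eqOn_of_eventuallyEq_ofReal {U : Set ℂ} {f g : ℂ → ℂ} (hU : IsOpen U)
    (hUc : IsPreconnected U) (hf : DifferentiableOn ℂ f U) (hg : DifferentiableOn ℂ g U) {t : ℝ}
    (ht : (t : ℂ) ∈ U) (hfg : ∀ᶠ s : ℝ in 𝓝 t, f s = g s) : EqOn f g U := by
  have hlim : Tendsto (fun s : ℝ ↦ (s : ℂ)) (𝓝[≠] t) (𝓝[≠] (t : ℂ)) :=
    Complex.continuous_ofReal.continuousWithinAt.tendsto_nhdsWithin fun s hs ↦ by simpa using hs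
  exact (hf.analyticOnNhd hU).eqOn_of_preconnected_of_frequently_eq (hg.analyticOnNhd hU) hUc ht
    (hlim.frequently (hfg.filter_mono nhdsWithin_le_nhds).frequently)

lemma eventuallyEq_of_eqOn_Ioo_ofReal {f g : ℂ → ℂ} {a b : ℝ} (hab : a < b) (hf : AnalyticAt ℂ f b)
    (hg : AnalyticAt ℂ g b) (hfg : ∀ t ∈ Ioo a b, f t = g t) : f =ᶠ[𝓝 (b : ℂ)] g := by
  refine (hf.frequently_eq_iff_eventually_eq hg).1 ?_
  have hlim : Tendsto (fun t : ℝ ↦ (t : ℂ)) (𝓝[<] b) (𝓝[≠] (b : ℂ)) :=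
    Complex.continuous_ofReal.continuousWithinAt.tendsto_nhdsWithin fun t ht ↦ by
      simpa using ht.ne
  exact hlim.frequently (Filter.Eventually.frequently
    (mem_of_superset (Ioo_mem_nhdsLT hab) hfg))

/-- The power series of the Taylor expansion at `x` of a function of a real variable. -/
noncomputable def taylorPowerSeries (h : ℝ → ℂ) (x : ℝ) : FormalMultilinearSeries ℂ ℂ ℂ :=
  ofScalars ℂ fun n ↦ iteratedDeriv n h x / n.factorial

/-- The sum, at a complex point, of the Taylor series at `x` of a function of a real variable. -/
noncomputable def taylorSum (h : ℝ → ℂ) (x : ℝ) (z : ℂ) : ℂ := (taylorPowerSeries h x).sum (z - x)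

lemma ofReal_mem_armDisk_iff {x t : ℝ} : (t : ℂ) ∈ armDisk x ↔ |t - x| < x / √2 := by
  rw [armDisk, mem_ball_iff_norm, ← Complex.ofReal_sub, Complex.norm_real, Real.norm_eq_abs]

lemma armDisk_subset_armRegion_of_mem_Ioc {L x : ℝ} (hx : x ∈ Ioc 0 L) :
    armDisk x ⊆ armRegion L := by
  intro z hz
  have hnear : ∀ᶠ y : ℝ in 𝓝[<] x, ‖z - y‖ < y / √2 :=
    nhdsWithin_le_nhds ((isOpen_lt (by fun_prop) (by fun_prop)).mem_nhds (mem_ball_iff_norm.1 hz))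
  obtain ⟨y, hzy, hy⟩ := (hnear.and (Ioo_mem_nhdsLT hx.1)).exists
  exact armDisk_subset_armRegion ⟨hy.1, hy.2.trans_le hx.2⟩ (mem_ball_iff_norm.2 hzy)

variable {L : ℝ} {h : ℝ → ℂ}

lemma le_radius_taylorPowerSeries (hh : ContDiffOn ℝ ∞ h (Ioo 0 L)) (hfin : armSum L h < ⊤)
    {x : ℝ} (hx : x ∈ Ioo 0 L) :
    ENNReal.ofReal (x / √2) ≤ (taylorPowerSeries h x).radius := by
  refine ENNReal.le_of_forall_pos_nnreal_lt fun r hr hrx ↦ ?_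
  obtain ⟨b, hxb, hbL⟩ := exists_between hx.2
  obtain ⟨C, hC⟩ := exists_forall_norm_iteratedDeriv_mul_pow_le hh hfin hx.1 hxb hbL hr
    (ENNReal.lt_ofReal_iff_toReal_lt ENNReal.coe_ne_top |>.1 hrx)
  refine le_radius_of_bound _ C fun n ↦ ?_
  rw [taylorPowerSeries, ofScalars_norm, norm_div, Complex.norm_natCast, div_mul_eq_mul_div,
    div_le_iff₀ (by positivity)]
  exact hC n x (left_mem_Icc.2 hxb.le)

lemma sub_mem_eball_radius_taylorPowerSeries (hh : ContDiffOn ℝ ∞ h (Ioo 0 L))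
    (hfin : armSum L h < ⊤) {x : ℝ} (hx : x ∈ Ioo 0 L) {z : ℂ} (hz : z ∈ armDisk x) :
    z - x ∈ Metric.eball 0 (taylorPowerSeries h x).radius := by
  refine Metric.eball_subset_eball (le_radius_taylorPowerSeries hh hfin hx) ?_
  rw [Metric.eball_ofReal, mem_ball_zero_iff]
  exact mem_ball_iff_norm.1 hz

lemma differentiableOn_taylorSum (hh : ContDiffOn ℝ ∞ h (Ioo 0 L)) (hfin : armSum L h < ⊤)
    {x : ℝ} (hx : x ∈ Ioo 0 L) : DifferentiableOn ℂ (taylorSum h x) (armDisk x) := by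
  have hx0 := hx.1
  have hrad : 0 < (taylorPowerSeries h x).radius :=
    (le_radius_taylorPowerSeries hh hfin hx).trans_lt' (by simpa using hx0)
  exact ((taylorPowerSeries h x).hasFPowerSeriesOnBall hrad).differentiableOn.comp (by fun_prop)
    fun z hz ↦ sub_mem_eball_radius_taylorPowerSeries hh hfin hx hz

lemma taylorSum_eq_of_sub_lt (hh : ContDiffOn ℝ ∞ h (Ioo 0 L)) (hfin : armSum L h < ⊤)
    {x y : ℝ} (hx : 0 < x) (hxy : x < y) (hy : y < L) (hd : y - x < x / √2) :
    taylorSum h x y = h y := by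
  obtain ⟨ρ, hdρ, hρx⟩ := exists_between hd
  have hρ : 0 < ρ := (sub_pos.2 hxy).trans hdρ
  obtain ⟨C, hC⟩ := exists_forall_norm_iteratedDeriv_mul_pow_le hh hfin hx hxy hy hρ hρx
  have hsmooth : ∀ t ∈ Icc x y, ContDiffAt ℝ ∞ h t := fun t ht ↦
    hh.contDiffAt (isOpen_Ioo.mem_nhds (Icc_subset_Ioo hx hy ht))
  have hreal := tendsto_taylorWithinEval_of_norm_iteratedDeriv_mul_pow_le hxy hsmooth hρ hC
    (right_mem_Icc.2 hxy.le) hdρ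
  have hmem : (y : ℂ) ∈ armDisk x := ofReal_mem_armDisk_iff.2 (by rwa [abs_of_pos (sub_pos.2 hxy)])
  have hcomplex := ((taylorPowerSeries h x).hasSum (sub_mem_eball_radius_taylorPowerSeries hh hfin
    ⟨hx, hxy.trans hy⟩ hmem)).tendsto_sum_nat.comp (tendsto_add_atTop_nat 1)
  refine tendsto_nhds_unique hcomplex (hreal.congr fun n ↦ ?_)
  rw [taylor_within_apply]
  refine Finset.sum_congr rfl fun k _ ↦ ?_
  rw [iteratedDerivWithin_eq_iteratedDeriv (uniqueDiffOn_Icc hxy)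
    ((hsmooth x (left_mem_Icc.2 hxy.le)).of_le (mod_cast le_top)) (left_mem_Icc.2 hxy.le),
    taylorPowerSeries, ofScalars_apply_eq, Complex.real_smul, smul_eq_mul]
  push_cast
  ring

lemma analyticAt_comp_ofReal {f : ℂ → ℂ} {t : ℝ} (hf : AnalyticAt ℂ f t) :
    AnalyticAt ℝ (fun s : ℝ ↦ f s) t :=
  AnalyticAt.fun_comp (f := fun s : ℝ ↦ (s : ℂ)) (hf.restrictScalars (𝕜 := ℝ))
    (Complex.ofRealCLM.analyticAt t)

lemma analyticAt_taylorSum_ofReal (hh : ContDiffOn ℝ ∞ h (Ioo 0 L)) (hfin : armSum L h < ⊤)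
    {x t : ℝ} (hx : x ∈ Ioo 0 L) (ht : (t : ℂ) ∈ armDisk x) :
    AnalyticAt ℝ (fun s : ℝ ↦ taylorSum h x s) t :=
  analyticAt_comp_ofReal
    ((differentiableOn_taylorSum hh hfin hx).analyticAt (isOpen_armDisk.mem_nhds ht))

theorem analyticOnNhd_of_armSum_lt_top (hh : ContDiffOn ℝ ∞ h (Ioo 0 L)) (hfin : armSum L h < ⊤) :
    AnalyticOnNhd ℝ h (Ioo 0 L) := by
  intro y hy
  obtain ⟨x, hdx, hx⟩ : ∃ x, y - x < x / √2 ∧ x ∈ Ioo 0 y := by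
    have hd : ∀ᶠ x in 𝓝[<] y, y - x < x / √2 :=
      nhdsWithin_le_nhds ((isOpen_lt (by fun_prop) (by fun_prop)).mem_nhds (by simpa using hy.1))
    exact (hd.and (Ioo_mem_nhdsLT hy.1)).exists
  have hxL : x ∈ Ioo 0 L := ⟨hx.1, hx.2.trans hy.2⟩
  refine (analyticAt_taylorSum_ofReal hh hfin hxL (ofReal_mem_armDisk_iff.2 ?_)).congr ?_
  · rwa [abs_of_pos (sub_pos.2 hx.2)]
  · have hd : ∀ᶠ t : ℝ in 𝓝 y, t - x < x / √2 :=
      (isOpen_lt (by fun_prop) (by fun_prop)).mem_nhds hdx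
    filter_upwards [Ioo_mem_nhds hx.2 hy.2, hd] with t ht htx
    exact taylorSum_eq_of_sub_lt hh hfin hx.1 ht.1 ht.2 htx

lemma taylorSum_ofReal_eq (hh : ContDiffOn ℝ ∞ h (Ioo 0 L)) (hfin : armSum L h < ⊤)
    {x t : ℝ} (hx : x ∈ Ioo 0 L) (ht : t ∈ Ioo 0 L) (htx : (t : ℂ) ∈ armDisk x) :
    taylorSum h x t = h t := by
  have hx0 := hx.1
  have hreal : EqOn (fun s : ℝ ↦ taylorSum h x s) h (Ioo 0 L ∩ Metric.ball x (x / √2)) := by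
    refine AnalyticOnNhd.eqOn_of_preconnected_of_frequently_eq (𝕜 := ℝ) (z₀ := x)
      (fun s hs ↦ analyticAt_taylorSum_ofReal hh hfin hx (ofReal_mem_armDisk_iff.2 hs.2))
      (fun s hs ↦ analyticOnNhd_of_armSum_lt_top hh hfin s hs.1)
      ((convex_Ioo _ _).inter (convex_ball _ _)).isPreconnected
      ⟨hx, Metric.mem_ball_self (by positivity)⟩ ?_
    have hright : ∀ᶠ s : ℝ in 𝓝[>] x, taylorSum h x s = h s := by
      have hd : ∀ᶠ s in 𝓝[>] x, s - x < x / √2 :=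
        nhdsWithin_le_nhds ((isOpen_lt (by fun_prop) (by fun_prop)).mem_nhds (by simpa using hx0))
      filter_upwards [Ioo_mem_nhdsGT hx.2, hd] with s hs hsx
      exact taylorSum_eq_of_sub_lt hh hfin hx0 hs.1 hs.2 hsx
    exact hright.frequently.filter_mono (nhdsWithin_mono _ fun s hs ↦ (ne_of_gt hs))
  exact hreal ⟨ht, ofReal_mem_armDisk_iff.1 htx⟩

lemma exists_ofReal_mem_armDisk_inter {x y : ℝ} (hx : 0 < x) (hy : 0 < y)
    (hxy : (armDisk x ∩ armDisk y).Nonempty) :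
    ∃ t ∈ uIcc x y, (t : ℂ) ∈ armDisk x ∩ armDisk y := by
  obtain ⟨z, hzx, hzy⟩ := hxy
  have hd : |y - x| < x / √2 + y / √2 := by
    rw [← Real.norm_eq_abs, ← Complex.norm_real, Complex.ofReal_sub,
      ← sub_sub_sub_cancel_left _ _ z]
    exact (norm_sub_le _ _).trans_lt (add_lt_add (mem_ball_iff_norm.1 hzx)
      (mem_ball_iff_norm.1 hzy))
  have hq : |y - x| / (x + y) < (√2)⁻¹ := by
    rwa [div_lt_iff₀ (by positivity), inv_mul_eq_div, add_div]
  refine ⟨2 * x * y / (x + y), ?_, ofReal_mem_armDisk_iff.2 ?_, ofReal_mem_armDisk_iff.2 ?_⟩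
  · rw [mem_uIcc, le_div_iff₀ (by positivity), div_le_iff₀ (by positivity),
      le_div_iff₀ (by positivity), div_le_iff₀ (by positivity)]
    rcases le_total x y with hle | hle
    · left
      constructor <;> nlinarith
    · right
      constructor <;> nlinarith
  · rw [show 2 * x * y / (x + y) - x = x * ((y - x) / (x + y)) by field_simp; ring, abs_mul,
      abs_div, abs_of_pos hx, abs_of_pos (add_pos hx hy), div_eq_mul_inv x]
    gcongr
  · rw [show 2 * x * y / (x + y) - y = y * ((x - y) / (x + y)) by field_simp; ring, abs_mul,
      abs_div, abs_of_pos hy, abs_of_pos (add_pos hx hy), abs_sub_comm, div_eq_mul_inv y]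
    gcongr

lemma taylorSum_eqOn_armDisk_inter (hh : ContDiffOn ℝ ∞ h (Ioo 0 L)) (hfin : armSum L h < ⊤)
    {x y : ℝ} (hx : x ∈ Ioo 0 L) (hy : y ∈ Ioo 0 L) :
    EqOn (taylorSum h x) (taylorSum h y) (armDisk x ∩ armDisk y) := by
  rcases (armDisk x ∩ armDisk y).eq_empty_or_nonempty with hempty | hne
  · simp [hempty]
  obtain ⟨t, ht, htxy⟩ := exists_ofReal_mem_armDisk_inter hx.1 hy.1 hne
  have htL : t ∈ Ioo 0 L := ordConnected_Ioo.uIcc_subset hx hy ht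
  have hopen : IsOpen (armDisk x ∩ armDisk y) := isOpen_armDisk.inter isOpen_armDisk
  refine eqOn_of_eventuallyEq_ofReal hopen
    ((convex_ball _ _).inter (convex_ball _ _)).isPreconnected
    ((differentiableOn_taylorSum hh hfin hx).mono inter_subset_left)
    ((differentiableOn_taylorSum hh hfin hy).mono inter_subset_right) htxy ?_
  filter_upwards [isOpen_Ioo.mem_nhds htL,
    (hopen.preimage Complex.continuous_ofReal).mem_nhds htxy] with s hs hsxy
  rw [taylorSum_ofReal_eq hh hfin hx hs hsxy.1, taylorSum_ofReal_eq hh hfin hy hs hsxy.2]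

theorem exists_differentiableOn_armRegion (hh : ContDiffOn ℝ ∞ h (Ioo 0 L))
    (hfin : armSum L h < ⊤) :
    ∃ f : ℂ → ℂ, DifferentiableOn ℂ f (armRegion L) ∧ ∀ t ∈ Ioo 0 L, f t = h t := by
  obtain ⟨f, hf, hf_eq⟩ := exists_differentiableOn_iUnion_of_eqOn
    (s := fun x : Ioo 0 L ↦ armDisk x) (f := fun x ↦ taylorSum h x) (𝕜 := ℂ)
    (fun _ ↦ isOpen_armDisk) (fun x ↦ differentiableOn_taylorSum hh hfin x.2)
    (fun x y ↦ taylorSum_eqOn_armDisk_inter hh hfin x.2 y.2)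
  rw [iUnion_coe_set] at hf
  refine ⟨f, hf, fun t ht ↦ ?_⟩
  have htt := ofReal_mem_armDisk ht.1
  rw [hf_eq ⟨t, ht⟩ htt]
  exact taylorSum_ofReal_eq hh hfin ht ht htt

end Extension

section Rotations

/-- Multiplication by `u` about the centre `1/2` of the square, a rotation for `‖u‖ = 1`. -/
noncomputable def centerRot (u z : ℂ) : ℂ := 1 / 2 + u * (z - 1 / 2)

/-- The fourth roots of unity, listed so that `centerRot (quarterTurn j) x`, for `j = 0, 1, 2, 3`,
are the four points at which `diagonalSum` evaluates the derivatives. -/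
noncomputable def quarterTurn : Fin 4 → ℂ := ![1, -1, -Complex.I, Complex.I]

lemma norm_quarterTurn (j : Fin 4) : ‖quarterTurn j‖ = 1 := by
  fin_cases j <;> simp [quarterTurn]

lemma quarterTurn_ne_zero (j : Fin 4) : quarterTurn j ≠ 0 :=
  norm_pos_iff.1 (by simp [norm_quarterTurn])

variable {u : ℂ}

lemma centerRot_inv_centerRot (hu : u ≠ 0) (z : ℂ) : centerRot u⁻¹ (centerRot u z) = z := by
  unfold centerRot
  field_simp
  ring

lemma centerRot_centerRot_inv (hu : u ≠ 0) (z : ℂ) : centerRot u (centerRot u⁻¹ z) = z := by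
  simpa using centerRot_inv_centerRot (inv_ne_zero hu) z

lemma centerRot_sub_half (u z : ℂ) : centerRot u z - 1 / 2 = u * (z - 1 / 2) :=
  add_sub_cancel_left _ _

lemma centerRot_half (u : ℂ) : centerRot u (1 / 2) = 1 / 2 := by simp [centerRot]

lemma centerRot_eq_add_mul (u z : ℂ) : centerRot u z = 1 / 2 - u / 2 + u * z := by
  unfold centerRot
  ring

lemma differentiable_centerRot (u : ℂ) : Differentiable ℂ (centerRot u) := by
  unfold centerRot
  fun_prop

lemma measurePreserving_centerRot (hu : ‖u‖ = 1) : MeasurePreserving (centerRot u) :=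
  (measurePreserving_add_left volume (1 / 2 : ℂ)).comp
    ((rotation ⟨u, mem_sphere_zero_iff_norm.2 hu⟩).measurePreserving.comp
      (measurePreserving_sub_right volume (1 / 2 : ℂ)))

lemma setLIntegral_preimage_centerRot (hu : ‖u‖ = 1) (g : ℂ → ℝ≥0∞) (s : Set ℂ) :
    ∫⁻ z in centerRot u ⁻¹' s, g (centerRot u z) = ∫⁻ z in s, g z := by
  have hu0 : u ≠ 0 := norm_pos_iff.1 (by simp [hu])
  exact (measurePreserving_centerRot hu).setLIntegral_comp_preimage_emb
    ((differentiable_centerRot u).continuous.measurableEmbedding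
      (Function.LeftInverse.injective (centerRot_inv_centerRot hu0))) g s

lemma centerRot_quarterTurn_zero (z : ℂ) : centerRot (quarterTurn 0) z = z := by
  simp [centerRot, quarterTurn]

lemma centerRot_quarterTurn_one (t : ℝ) : centerRot (quarterTurn 1) t = ((1 - t : ℝ) : ℂ) := by
  simp only [centerRot, quarterTurn, Matrix.cons_val]
  push_cast
  ring

lemma centerRot_quarterTurn_two (t : ℝ) :
    centerRot (quarterTurn 2) t = 1 / 2 + Complex.I * ((1 / 2 - t : ℝ) : ℂ) := by
  simp only [centerRot, quarterTurn, Matrix.cons_val]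
  push_cast
  ring

lemma centerRot_quarterTurn_three (t : ℝ) :
    centerRot (quarterTurn 3) t = 1 / 2 + Complex.I * ((t - 1 / 2 : ℝ) : ℂ) := by
  simp only [centerRot, quarterTurn, Matrix.cons_val]
  push_cast
  ring

end Rotations

section Square

variable {f : ℂ → ℂ}

lemma isOpen_square : IsOpen square :=
  isOpen_lt (by fun_prop) continuous_const

lemma centerRot_quarterTurn_mem_square_iff (j : Fin 4) (z : ℂ) :
    centerRot (quarterTurn j) z ∈ square ↔ z ∈ square := by
  have hsub : ∀ w : ℂ, w ∈ square ↔ |(w - 1 / 2).re| + |(w - 1 / 2).im| < 1 / 2 := fun w ↦ by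
    simp [square]
  rw [hsub, hsub, centerRot_sub_half]
  fin_cases j <;> simp [quarterTurn, add_comm, abs_sub_comm]

lemma armRegion_subset_square : armRegion (1 / 2) ⊆ square := by
  refine iUnion₂_subset fun x hx z hz ↦ ?_
  rw [mem_armDisk_iff hx.1, sq_norm_sub_ofReal] at hz
  change |z.re - 1 / 2| + |z.im| < 1 / 2
  have hdist : |z.re - x| + |z.im| < x := by
    refine lt_of_pow_lt_pow_left₀ 2 hx.1.le ?_
    linarith [add_sq_le (a := |z.re - x|) (b := |z.im|), sq_abs (z.re - x), sq_abs z.im]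
  have htri : |z.re - 1 / 2| ≤ |z.re - x| + |x - 1 / 2| := abs_sub_le _ _ _
  rw [abs_of_neg (sub_neg.2 hx.2)] at htri
  linarith

lemma re_centerRot_quarterTurn_inv (j : Fin 4) (z : ℂ) : (centerRot (quarterTurn j)⁻¹ z).re =
    1 / 2 + ![z.re - 1 / 2, -(z.re - 1 / 2), -z.im, z.im] j := by
  fin_cases j <;> simp [centerRot, quarterTurn]

lemma im_centerRot_quarterTurn_inv (j : Fin 4) (z : ℂ) : (centerRot (quarterTurn j)⁻¹ z).im =
    ![z.im, -z.im, z.re - 1 / 2, -(z.re - 1 / 2)] j := by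
  fin_cases j <;> simp [centerRot, quarterTurn]

lemma exists_centerRot_inv_mem_quarter {z : ℂ} (hz : z ∈ square) :
    ∃ j, centerRot (quarterTurn j)⁻¹ z ∈ quarter (1 / 2) := by
  change |z.re - 1 / 2| + |z.im| < 1 / 2 at hz
  simp only [quarter, mem_ofPred_eq, re_centerRot_quarterTurn_inv, im_centerRot_quarterTurn_inv]
  rcases le_total |z.im| |z.re - 1 / 2| with h | h
  · rcases le_total 0 (z.re - 1 / 2) with hre | hre
    · refine ⟨1, ?_⟩
      simp only [abs_of_nonneg hre, Matrix.cons_val, abs_neg] at h hz ⊢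
      constructor <;> linarith
    · refine ⟨0, ?_⟩
      simp only [abs_of_nonpos hre, Matrix.cons_val] at h hz ⊢
      constructor <;> linarith
  · rcases le_total 0 z.im with him | him
    · refine ⟨2, ?_⟩
      simp only [abs_of_nonneg him, Matrix.cons_val] at h hz ⊢
      constructor <;> linarith
    · refine ⟨3, ?_⟩
      simp only [abs_of_nonpos him, Matrix.cons_val, abs_neg] at h hz ⊢
      constructor <;> linarith

lemma differentiableOn_comp_centerRot_quarterTurn (hf : DifferentiableOn ℂ f square) (j : Fin 4) :
    DifferentiableOn ℂ (fun z ↦ f (centerRot (quarterTurn j) z)) (armRegion (1 / 2)) :=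
  hf.comp (differentiable_centerRot _).differentiableOn fun z hz ↦
    (centerRot_quarterTurn_mem_square_iff j z).2 (armRegion_subset_square hz)

lemma armSum_comp_centerRot_le (hf : DifferentiableOn ℂ f square) (j : Fin 4) :
    armSum (1 / 2) (fun t ↦ f (centerRot (quarterTurn j) t)) ≤ bergmanNormSq f := by
  have hsq : centerRot (quarterTurn j) ⁻¹' square = square :=
    Set.ext (centerRot_quarterTurn_mem_square_iff j)
  calc armSum (1 / 2) (fun t ↦ f (centerRot (quarterTurn j) t))
      ≤ ∫⁻ z in armRegion (1 / 2), ‖f (centerRot (quarterTurn j) z)‖ₑ ^ 2 :=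
        armSum_le_setLIntegral (f := fun z ↦ f (centerRot (quarterTurn j) z))
          (differentiableOn_comp_centerRot_quarterTurn hf j)
    _ ≤ ∫⁻ z in centerRot (quarterTurn j) ⁻¹' square, ‖f (centerRot (quarterTurn j) z)‖ₑ ^ 2 :=
        lintegral_mono_set (armRegion_subset_square.trans hsq.ge)
    _ = bergmanNormSq f :=
        setLIntegral_preimage_centerRot (norm_quarterTurn j) (fun z ↦ ‖f z‖ₑ ^ 2) square

lemma bergmanNormSq_le_sum_setLIntegral_quarter (f : ℂ → ℂ) :
    bergmanNormSq f ≤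
      ∑ j, ∫⁻ z in quarter (1 / 2), ‖f (centerRot (quarterTurn j) z)‖ₑ ^ 2 := by
  have hcover : square ⊆ ⋃ j, centerRot (quarterTurn j)⁻¹ ⁻¹' quarter (1 / 2) := fun z hz ↦
    mem_iUnion.2 (exists_centerRot_inv_mem_quarter hz)
  calc bergmanNormSq f
      ≤ ∫⁻ z in ⋃ j, centerRot (quarterTurn j)⁻¹ ⁻¹' quarter (1 / 2), ‖f z‖ₑ ^ 2 :=
        lintegral_mono_set hcover
    _ ≤ ∑' j, ∫⁻ z in centerRot (quarterTurn j)⁻¹ ⁻¹' quarter (1 / 2), ‖f z‖ₑ ^ 2 :=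
        lintegral_iUnion_le _ _
    _ = ∑ j, ∫⁻ z in quarter (1 / 2), ‖f (centerRot (quarterTurn j) z)‖ₑ ^ 2 := by
        rw [tsum_fintype]
        refine Finset.sum_congr rfl fun j _ ↦ ?_
        have hnorm : ‖(quarterTurn j)⁻¹‖ = 1 := by rw [norm_inv, norm_quarterTurn, inv_one]
        simp only [← setLIntegral_preimage_centerRot hnorm (fun z ↦
          ‖f (centerRot (quarterTurn j) z)‖ₑ ^ 2), centerRot_centerRot_inv (quarterTurn_ne_zero j)]

theorem sum_armSum_le_bergmanNormSq (hf : DifferentiableOn ℂ f square) :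
    ∑ j, armSum (1 / 2) (fun t ↦ f (centerRot (quarterTurn j) t)) ≤ 4 * bergmanNormSq f :=
  (Finset.sum_le_sum fun j _ ↦ armSum_comp_centerRot_le hf j).trans_eq (by simp)

theorem bergmanNormSq_le_sum_armSum (hf : DifferentiableOn ℂ f square) :
    1 / 4 * bergmanNormSq f ≤ ∑ j, armSum (1 / 2) (fun t ↦ f (centerRot (quarterTurn j) t)) := by
  grw [bergmanNormSq_le_sum_setLIntegral_quarter, Finset.mul_sum]
  exact Finset.sum_le_sum fun j _ ↦
    setLIntegral_quarter_le_armSum (differentiableOn_comp_centerRot_quarterTurn hf j)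

lemma diagonalSum_eq_sum_armSum {d : ℕ → ℂ → ℂ}
    (hf : ∀ j, ContDiffOn ℝ ∞ (fun t : ℝ ↦ f (centerRot (quarterTurn j) t)) (Ioo 0 (1 / 2)))
    (hd : ∀ n j, ∀ x ∈ Ioo (0 : ℝ) (1 / 2), ‖d n (centerRot (quarterTurn j) x)‖ =
      ‖iteratedDeriv n (fun t : ℝ ↦ f (centerRot (quarterTurn j) t)) x‖) :
    diagonalSum d = ∑ j, armSum (1 / 2) (fun t ↦ f (centerRot (quarterTurn j) t)) := by
  unfold diagonalSum armSum
  rw [← Summable.tsum_finsetSum fun _ _ ↦ ENNReal.summable]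
  refine tsum_congr fun n ↦ ?_
  rw [← Finset.mul_sum, ← lintegral_finsetSum']
  · refine congrArg _ (setLIntegral_congr_fun measurableSet_Ioo fun x hx ↦ ?_)
    have hx0 := hx.1
    simp only [← hd n _ x hx]
    rw [← ENNReal.ofReal_sum_of_nonneg fun _ _ ↦ by positivity, ← Finset.mul_sum,
      Fin.sum_univ_four, centerRot_quarterTurn_zero, centerRot_quarterTurn_one,
      centerRot_quarterTurn_two, centerRot_quarterTurn_three]
    push_cast
    rfl
  · intro j _
    have hcont := continuousOn_iteratedDeriv_of_isOpen isOpen_Ioo (hf j) n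
    exact (ContinuousOn.aemeasurable (by fun_prop) measurableSet_Ioo).ennreal_ofReal

lemma diagonalSum_iteratedDeriv (hf : DifferentiableOn ℂ f square) :
    diagonalSum (fun n ↦ iteratedDeriv n f) =
      ∑ j, armSum (1 / 2) (fun t ↦ f (centerRot (quarterTurn j) t)) := by
  have hmem : ∀ j, ∀ t ∈ Ioo (0 : ℝ) (1 / 2),
      1 / 2 - quarterTurn j / 2 + quarterTurn j * t ∈ square := fun j t ht ↦ by
    rw [← centerRot_eq_add_mul, centerRot_quarterTurn_mem_square_iff]
    exact armRegion_subset_square (ofReal_mem_armRegion ht)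
  refine diagonalSum_eq_sum_armSum (fun j ↦ ?_) (fun n j t ht ↦ ?_) <;>
    simp only [centerRot_eq_add_mul]
  · exact contDiffOn_comp_affine isOpen_square hf _ _ (hmem j)
  · rw [iteratedDeriv_comp_affine isOpen_square hf _ _ n (hmem j t ht), norm_mul, norm_pow,
      norm_quarterTurn, one_pow, one_mul]

lemma norm_derivAlongDiagonals_centerRot_quarterTurn (f : ℂ → ℂ) (n : ℕ) (j : Fin 4) {x : ℝ}
    (hx : x < 1 / 2) : ‖derivAlongDiagonals f n (centerRot (quarterTurn j) x)‖ =
      ‖iteratedDeriv n (fun t : ℝ ↦ f (centerRot (quarterTurn j) t)) x‖ := by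
  have him : ∀ t : ℝ, (1 / 2 + Complex.I * (t : ℂ)).im = t := by simp
  fin_cases j
  · simp [centerRot_quarterTurn_zero, derivAlongDiagonals]
  · simp only [Fin.mk_one, centerRot_quarterTurn_one, derivAlongDiagonals, Complex.ofReal_im,
      if_true, Complex.ofReal_re]
    rw [iteratedDeriv_comp_const_sub n (fun s : ℝ ↦ f s)]
    simp
  · simp only [Fin.reduceFinMk, centerRot_quarterTurn_two, derivAlongDiagonals, him]
    rw [if_neg (by linarith),
      iteratedDeriv_comp_const_sub n (fun s : ℝ ↦ f (1 / 2 + Complex.I * s))]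
    simp
  · simp only [Fin.reduceFinMk, centerRot_quarterTurn_three, derivAlongDiagonals, him]
    rw [if_neg (by linarith),
      iteratedDeriv_comp_sub_const n (fun s : ℝ ↦ f (1 / 2 + Complex.I * s))]
    simp

lemma contDiffOn_comp_centerRot_quarterTurn (hf : SmoothOnDiagonals f) (j : Fin 4) :
    ContDiffOn ℝ ∞ (fun t : ℝ ↦ f (centerRot (quarterTurn j) t)) (Ioo 0 (1 / 2)) := by
  fin_cases j
  · simp only [Fin.zero_eta, centerRot_quarterTurn_zero]
    exact hf.1.mono (Ioo_subset_Ioo_right (by norm_num))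
  · simp only [Fin.mk_one, centerRot_quarterTurn_one]
    exact hf.1.comp (f := fun t : ℝ ↦ 1 - t) (by fun_prop)
      fun t ht ↦ ⟨by linarith [ht.2], by linarith [ht.1]⟩
  · simp only [Fin.reduceFinMk, centerRot_quarterTurn_two]
    exact hf.2.comp (f := fun t : ℝ ↦ 1 / 2 - t) (by fun_prop)
      fun t ht ↦ ⟨by linarith [ht.2], by linarith [ht.1]⟩
  · simp only [Fin.reduceFinMk, centerRot_quarterTurn_three]
    exact hf.2.comp (f := fun t : ℝ ↦ t - 1 / 2) (by fun_prop)
      fun t ht ↦ ⟨by linarith [ht.1], by linarith [ht.2]⟩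

lemma diagonalSum_derivAlongDiagonals (hf : SmoothOnDiagonals f) :
    diagonalSum (derivAlongDiagonals f) =
      ∑ j, armSum (1 / 2) (fun t ↦ f (centerRot (quarterTurn j) t)) :=
  diagonalSum_eq_sum_armSum (contDiffOn_comp_centerRot_quarterTurn hf) fun n j _ hx ↦
    norm_derivAlongDiagonals_centerRot_quarterTurn f n j hx.2

lemma exists_eq_centerRot_quarterTurn {z : ℂ} (hz : z ∈ horizontalDiagonal ∪ verticalDiagonal) :
    z = 1 / 2 ∨ ∃ j, ∃ t ∈ Ioo (0 : ℝ) (1 / 2), z = centerRot (quarterTurn j) t := by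
  rcases hz with ⟨⟨h0, h1⟩, him⟩ | ⟨hre, h0, h1⟩
  · rcases lt_trichotomy z.re (1 / 2) with h | h | h
    · refine Or.inr ⟨0, z.re, ⟨h0, h⟩, ?_⟩
      rw [centerRot_quarterTurn_zero]
      exact Complex.ext rfl him
    · exact Or.inl (Complex.ext (by simp [h]) (by simp [him]))
    · refine Or.inr ⟨1, 1 - z.re, ⟨by linarith, by linarith⟩, ?_⟩
      rw [centerRot_quarterTurn_one]
      exact Complex.ext (by simp) (by simp [him])
  · rcases lt_trichotomy z.im 0 with h | h | h
    · refine Or.inr ⟨3, 1 / 2 + z.im, ⟨by linarith, by linarith⟩, ?_⟩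
      rw [centerRot_quarterTurn_three]
      exact Complex.ext (by simp [hre]) (by simp)
    · exact Or.inl (Complex.ext (by simp [hre]) (by simp [h]))
    · refine Or.inr ⟨2, 1 / 2 - z.im, ⟨by linarith, by linarith⟩, ?_⟩
      rw [centerRot_quarterTurn_two]
      exact Complex.ext (by simp [hre]) (by simp)

/-- The part of the square, around the arm that ends at the vertex `centerRot (quarterTurn j) 0`,
to which a function of finite arm sum extends holomorphically. -/
noncomputable def turnedRegion (j : Fin 4) : Set ℂ :=
  centerRot (quarterTurn j)⁻¹ ⁻¹' armRegion (1 / 2)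

/-- The largest disc about the centre of the square that the square contains. -/
noncomputable def inscribedDisk : Set ℂ := armDisk (1 / 2)

lemma isOpen_turnedRegion (j : Fin 4) : IsOpen (turnedRegion j) :=
  isOpen_armRegion.preimage (differentiable_centerRot _).continuous

lemma iUnion_turnedRegion : ⋃ j, turnedRegion j = square := by
  refine Subset.antisymm (iUnion_subset fun j z hz ↦ ?_) fun z hz ↦ ?_
  · rw [← centerRot_centerRot_inv (quarterTurn_ne_zero j) z, centerRot_quarterTurn_mem_square_iff]
    exact armRegion_subset_square hz
  · obtain ⟨j, hj⟩ := exists_centerRot_inv_mem_quarter hz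
    exact mem_iUnion.2 ⟨j, quarter_subset_armRegion hj⟩

lemma half_mem_inscribedDisk : (1 / 2 : ℂ) ∈ inscribedDisk := by
  simpa [inscribedDisk] using ofReal_mem_armDisk (x := 1 / 2) one_half_pos

lemma inscribedDisk_subset_armRegion : inscribedDisk ⊆ armRegion (1 / 2) :=
  armDisk_subset_armRegion_of_mem_Ioc (right_mem_Ioc.2 (by norm_num))

lemma centerRot_inv_quarterTurn_mem_inscribedDisk_iff (j : Fin 4) {z : ℂ} :
    centerRot (quarterTurn j)⁻¹ z ∈ inscribedDisk ↔ z ∈ inscribedDisk := by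
  rw [inscribedDisk, armDisk, mem_ball_iff_norm, mem_ball_iff_norm,
    show ((1 / 2 : ℝ) : ℂ) = 1 / 2 by norm_num, centerRot_sub_half, norm_mul, norm_inv,
    norm_quarterTurn, inv_one, one_mul]

lemma inscribedDisk_subset_turnedRegion (j : Fin 4) : inscribedDisk ⊆ turnedRegion j := fun _ hz ↦
  inscribedDisk_subset_armRegion ((centerRot_inv_quarterTurn_mem_inscribedDisk_iff j).2 hz)

lemma half_mem_turnedRegion (j : Fin 4) : 1 / 2 ∈ turnedRegion j :=
  inscribedDisk_subset_turnedRegion j half_mem_inscribedDisk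

lemma re_lt_or_mem_inscribedDisk {z : ℂ} (hz : z ∈ armRegion (1 / 2)) :
    z.re < 1 / 4 ∨ z ∈ inscribedDisk := by
  obtain ⟨x, hx, hzx⟩ := mem_iUnion₂.1 hz
  refine or_iff_not_imp_left.2 fun hre ↦ ?_
  rw [inscribedDisk, mem_armDisk_iff (by norm_num), sq_norm_sub_ofReal]
  rw [mem_armDisk_iff hx.1, sq_norm_sub_ofReal] at hzx
  nlinarith [mul_nonneg (sub_nonneg.2 hx.2.le) (sub_nonneg.2 (not_lt.1 hre)), sq_nonneg (1 / 2 - x)]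

lemma turnedRegion_inter_subset {i j : Fin 4} (hij : i ≠ j) :
    turnedRegion i ∩ turnedRegion j ⊆ inscribedDisk := by
  rintro z ⟨hi, hj⟩
  have hz : z ∈ square := iUnion_turnedRegion ▸ mem_iUnion.2 ⟨i, hi⟩
  by_contra hzD
  have hre_lt : ∀ k, z ∈ turnedRegion k → (centerRot (quarterTurn k)⁻¹ z).re < 1 / 4 :=
    fun k hk ↦ (re_lt_or_mem_inscribedDisk hk).resolve_right
      (mt (centerRot_inv_quarterTurn_mem_inscribedDisk_iff k).1 hzD)
  replace hi := hre_lt i hi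
  replace hj := hre_lt j hj
  simp only [square, mem_ofPred_eq] at hz
  rw [re_centerRot_quarterTurn_inv] at hi hj
  have hre := abs_le.1 (le_refl |z.re - 1 / 2|)
  have him := abs_le.1 (le_refl |z.im|)
  fin_cases i <;> fin_cases j <;> simp at hij hi hj <;> linarith

lemma exists_differentiableOn_turnedRegion (hf : AnalyticAt ℂ f (1 / 2)) {j : Fin 4}
    (hfj : ContDiffOn ℝ ∞ (fun t : ℝ ↦ f (centerRot (quarterTurn j) t)) (Ioo 0 (1 / 2)))
    (hfin : armSum (1 / 2) (fun t ↦ f (centerRot (quarterTurn j) t)) < ⊤) :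
    ∃ H : ℂ → ℂ, DifferentiableOn ℂ H (turnedRegion j) ∧ H =ᶠ[𝓝 (1 / 2)] f ∧
      ∀ t ∈ Ioo (0 : ℝ) (1 / 2),
        H (centerRot (quarterTurn j) t) = f (centerRot (quarterTurn j) t) := by
  obtain ⟨G, hG, hGf⟩ := exists_differentiableOn_armRegion hfj hfin
  have hhalf : ((1 / 2 : ℝ) : ℂ) = 1 / 2 := by norm_num
  have hgerm : G =ᶠ[𝓝 (1 / 2)] fun z ↦ f (centerRot (quarterTurn j) z) := by
    rw [← hhalf]
    refine eventuallyEq_of_eqOn_Ioo_ofReal one_half_pos ?_ ?_ hGf <;> rw [hhalf]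
    · exact hG.analyticAt
        (isOpen_armRegion.mem_nhds (inscribedDisk_subset_armRegion half_mem_inscribedDisk))
    · exact AnalyticAt.fun_comp ((centerRot_half _).symm ▸ hf)
        ((differentiable_centerRot _).analyticAt _)
  refine ⟨fun z ↦ G (centerRot (quarterTurn j)⁻¹ z),
    hG.comp (differentiable_centerRot _).differentiableOn fun z hz ↦ hz, ?_, fun t ht ↦ ?_⟩
  · have hlim : Tendsto (centerRot (quarterTurn j)⁻¹) (𝓝 (1 / 2)) (𝓝 (1 / 2)) := by
      simpa only [centerRot_half] using
        (differentiable_centerRot (quarterTurn j)⁻¹).continuous.tendsto (1 / 2)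
    filter_upwards [hlim.eventually hgerm] with z hz
    rw [hz, centerRot_centerRot_inv (quarterTurn_ne_zero j)]
  · simp only [centerRot_inv_centerRot (quarterTurn_ne_zero j)]
    exact hGf t ht

lemma exists_differentiableOn_square_of_eventuallyEq {H : Fin 4 → ℂ → ℂ}
    (hH : ∀ j, DifferentiableOn ℂ (H j) (turnedRegion j)) (hHf : ∀ j, H j =ᶠ[𝓝 (1 / 2)] f) :
    ∃ F : ℂ → ℂ, DifferentiableOn ℂ F square ∧ ∀ j, EqOn F (H j) (turnedRegion j) := by
  rw [← iUnion_turnedRegion]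
  refine exists_differentiableOn_iUnion_of_eqOn isOpen_turnedRegion hH fun i j ↦ ?_
  rcases eq_or_ne i j with rfl | hij
  · exact fun _ _ ↦ rfl
  have han : ∀ k, AnalyticOnNhd ℂ (H k) inscribedDisk := fun k ↦
    ((hH k).mono (inscribedDisk_subset_turnedRegion k)).analyticOnNhd isOpen_armDisk
  exact ((han i).eqOn_of_preconnected_of_eventuallyEq (han j) (convex_ball _ _).isPreconnected
    half_mem_inscribedDisk ((hHf i).trans (hHf j).symm)).mono (turnedRegion_inter_subset hij)

theorem exists_differentiableOn_square (hf : AnalyticAt ℂ f (1 / 2))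
    (hsmooth : ∀ j, ContDiffOn ℝ ∞ (fun t : ℝ ↦ f (centerRot (quarterTurn j) t)) (Ioo 0 (1 / 2)))
    (hfin : ∀ j, armSum (1 / 2) (fun t ↦ f (centerRot (quarterTurn j) t)) < ⊤) :
    ∃ F : ℂ → ℂ, DifferentiableOn ℂ F square ∧ F =ᶠ[𝓝 (1 / 2)] f ∧
      ∀ j, ∀ t ∈ Ioo (0 : ℝ) (1 / 2),
        F (centerRot (quarterTurn j) t) = f (centerRot (quarterTurn j) t) := by
  choose H hH hHf hH_eq using fun j ↦ exists_differentiableOn_turnedRegion hf (hsmooth j) (hfin j)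
  obtain ⟨F, hF, hFH⟩ := exists_differentiableOn_square_of_eventuallyEq hH hHf
  refine ⟨F, hF, ?_, fun j t ht ↦ ?_⟩
  · exact ((hFH 0).eventuallyEq_of_mem
      ((isOpen_turnedRegion 0).mem_nhds (half_mem_turnedRegion 0))).trans (hHf 0)
  · rw [hFH j, hH_eq j t ht]
    rw [turnedRegion, mem_preimage, centerRot_inv_centerRot (quarterTurn_ne_zero j)]
    exact ofReal_mem_armRegion ht

end Square

theorem diagonalSum_bounds {f : ℂ → ℂ} (hf : DifferentiableOn ℂ f square) :
    1 / 4 * bergmanNormSq f ≤ diagonalSum (fun n ↦ iteratedDeriv n f) ∧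
      diagonalSum (fun n ↦ iteratedDeriv n f) ≤ 4 * bergmanNormSq f := by
  rw [diagonalSum_iteratedDeriv hf]
  exact ⟨bergmanNormSq_le_sum_armSum hf, sum_armSum_le_bergmanNormSq hf⟩

theorem exists_extension_of_diagonalSum_lt_top {f : ℂ → ℂ} (hf : SmoothOnDiagonals f)
    (hhalf : AnalyticAt ℂ f (1 / 2)) (hfin : diagonalSum (derivAlongDiagonals f) < ⊤) :
    ∃ F : ℂ → ℂ, MemBergman F ∧ EqOn F f (horizontalDiagonal ∪ verticalDiagonal) ∧
      F =ᶠ[𝓝 (1 / 2)] f ∧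
      diagonalSum (derivAlongDiagonals f) = diagonalSum (fun n ↦ iteratedDeriv n F) := by
  have hsum := diagonalSum_derivAlongDiagonals hf
  obtain ⟨F, hF, hgerm, hFf⟩ := exists_differentiableOn_square hhalf
    (contDiffOn_comp_centerRot_quarterTurn hf) fun j ↦
      (Finset.single_le_sum_of_canonicallyOrdered (Finset.mem_univ j)).trans_lt (hsum ▸ hfin)
  have hsumF : diagonalSum (derivAlongDiagonals f) = diagonalSum (fun n ↦ iteratedDeriv n F) := by
    rw [hsum, diagonalSum_iteratedDeriv hF]
    exact Finset.sum_congr rfl fun j _ ↦ armSum_congr fun t ht ↦ (hFf j t ht).symm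
  refine ⟨F, ⟨hF, ?_⟩, fun z hz ↦ ?_, hgerm, hsumF⟩
  · exact ENNReal.lt_top_of_mul_ne_top_right
      ((diagonalSum_bounds hF).1.trans_lt (hsumF ▸ hfin)).ne (by simp)
  · rcases exists_eq_centerRot_quarterTurn hz with rfl | ⟨j, t, ht, rfl⟩
    · exact hgerm.self_of_nhds
    · exact hFf j t ht

theorem mainTheorem1_general :
    (∀ f : ℂ → ℂ, DifferentiableOn ℂ f square →
      1 / 4 * bergmanNormSq f ≤ diagonalSum (fun n ↦ iteratedDeriv n f) ∧
      diagonalSum (fun n ↦ iteratedDeriv n f) ≤ 4 * bergmanNormSq f) ∧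
    (∀ f : ℂ → ℂ, SmoothOnDiagonals f →
      (∃ U : Set ℂ, IsOpen U ∧ (1 / 2 : ℂ) ∈ U ∧ DifferentiableOn ℂ f U) →
      diagonalSum (derivAlongDiagonals f) < ⊤ →
      ∃ F : ℂ → ℂ, MemBergman F ∧
        EqOn F f (horizontalDiagonal ∪ verticalDiagonal) ∧
        F =ᶠ[𝓝 (1 / 2 : ℂ)] f ∧
        1 / 4 * bergmanNormSq F ≤ diagonalSum (derivAlongDiagonals f) ∧
        diagonalSum (derivAlongDiagonals f) ≤ 4 * bergmanNormSq F) := by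
  refine ⟨fun f hf ↦ diagonalSum_bounds hf, fun f hf ⟨U, hU, hmem, hfU⟩ hfin ↦ ?_⟩
  obtain ⟨F, hF, hFf, hgerm, hsum⟩ := exists_extension_of_diagonalSum_lt_top hf
    (hfU.analyticAt (hU.mem_nhds hmem)) hfin
  exact ⟨F, hF, hFf, hgerm, hsum ▸ diagonalSum_bounds hF.1⟩

theorem mainTheorem1 :
    ∃ c C : ℝ≥0, 0 < c ∧ 0 < C ∧
      (∀ f : ℂ → ℂ, MemBergman f →
        (c : ℝ≥0∞) * bergmanNormSq f ≤ diagonalSum (fun n => iteratedDeriv n f) ∧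
        diagonalSum (fun n => iteratedDeriv n f) ≤ (C : ℝ≥0∞) * bergmanNormSq f) ∧
      (∀ f : ℂ → ℂ, SmoothOnDiagonals f →
        (∃ U : Set ℂ, IsOpen U ∧ (1 / 2 : ℂ) ∈ U ∧ DifferentiableOn ℂ f U) →
        diagonalSum (derivAlongDiagonals f) < ⊤ →
        ∃ F : ℂ → ℂ, MemBergman F ∧
          EqOn F f (horizontalDiagonal ∪ verticalDiagonal) ∧
          F =ᶠ[𝓝 (1 / 2 : ℂ)] f ∧
          (c : ℝ≥0∞) * bergmanNormSq F ≤ diagonalSum (derivAlongDiagonals f) ∧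
          diagonalSum (derivAlongDiagonals f) ≤ (C : ℝ≥0∞) * bergmanNormSq F) := by
  have hc : ((1 / 4 : ℝ≥0) : ℝ≥0∞) = 1 / 4 := by norm_num
  exact ⟨1 / 4, 4, by norm_num, by norm_num,
    by simpa only [hc] using ⟨fun f hf ↦ mainTheorem1_general.1 f hf.1, mainTheorem1_general.2⟩⟩
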